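/- **Setting.** Let $\mathfrak g$ be a finite-dimensional simple complex Lie algebra with Cartan subalgebra $\mathfrak h$, root system $\Delta=\Delta^+\sqcup\Delta^-$, simple roots $\{\alpha_i\}_{i\in I}$, root lattice $Q$, highest root $\theta$ (the root of maximal height), and a nondegenerate symmetric invariant form $(\cdot,\cdot)$. Let $\widetilde{\mathfrak g}=\mathfrak g\otimes\mathbb C[t,t^{-1}]\oplus\mathbb C c$ be the affine Lie algebra, with $c$ central and $[xt^n,yt^m]=[x,y]t^{n+m}+n\,\delta_{n,-m}(x,y)\,c$. Put $\widehat I=I\sqcup\{0\}$, choose nonzero root vectors $e_{\alpha_i}\in\mathfrak g_{\alpha_i}$ ($i\in I$) and $f_\theta\in\mathfrak g_{-\theta}$, and set $e_i=e_{\alpha_i}t^0$ for $i\in I$ and $e_0=f_\theta t^1$. Let $\widehat{\mathfrak n}^+\subset\widetilde{\mathfrak g}$ be the positive subalgebra, i.e. the Lie subalgebra generated by $\{e_i\}_{i\in\widehat I}$. In $Q\times\mathbb Z$, write $\alpha_i$ for $(\alpha_i,0)$ ($i\in I$), $\alpha_0=(-\theta,1)$, $\delta=(0,1)$. The positive real affine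 roots are $\widehat\Delta^{+,\mathrm{re}}=(\Delta^+\times\mathbb Z_{\ge0})\sqcup(\Delta^-\times\mathbb Z_{>0})$, the positive imaginary ones are $\widehat\Delta^{+,\mathrm{im}}=\{k\delta: k\ge1\}$, and $\widehat\Delta^+=\widehat\Delta^{+,\mathrm{re}}\sqcup\widehat\Delta^{+,\mathrm{im}}$. **Words.** Fix any total order on $\widehat I$ and order the words in $\widehat I$ lexicographically (a proper prefix of a word is smaller than the word). A nonempty word is *Lyndon* if it is smaller than all its proper suffixes. The *standard bracketing* of a Lyndon word is defined by $\mathsf b[i]=e_i$ and $\mathsf b[\ell]=[\mathsf b[\ell_1],\mathsf b[\ell_2]]$, where $\ell=\ell_1\ell_2$ and $\ell_2$ is the longest proper suffix of $\ell$ that is Lyndon. A Lyndon word $\ell$ is *(affine) standard Lyndon* if $\mathsf b[\ell]$ is not a linear combination of the $\mathsf b[m]$ with $m>\ell$ Lyndon. The *degree* of $[i_1\dots i_k]$ is $\alpha_{i_1}+\dots+\alpha_{i_k}$. **Proposition (generalized Leclerc algorithm).** Every affine standard Lyndon word has degree in $\widehat\Delta^+$. There is exactly one affine standard Lyndon word $\mathrm{SL}(\alpha)$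 in each degree $\alpha\in\widehat\Delta^{+,\mathrm{re}}$ and there are exactly $|I|$ of them, $\mathrm{SL}_1(\alpha)>\dots>\mathrm{SL}_{|I|}(\alpha)$, in each degree $\alpha\in\widehat\Delta^{+,\mathrm{im}}$. For $\alpha\in\widehat\Delta^+$ let $C(\alpha)$ be the set of all concatenations $\mathrm{SL}_*(\gamma_1)\mathrm{SL}_*(\gamma_2)$ with $\gamma_1,\gamma_2\in\widehat\Delta^+$, $\gamma_1+\gamma_2=\alpha$, $\mathrm{SL}_*(\gamma_1)<\mathrm{SL}_*(\gamma_2)$ and $[\mathsf b[\mathrm{SL}_*(\gamma_1)],\mathsf b[\mathrm{SL}_*(\gamma_2)]]\ne0$, where $\mathrm{SL}_*(\gamma)$ denotes $\mathrm{SL}(\gamma)$ for real $\gamma$ and any of $\mathrm{SL}_1(\gamma),\dots,\mathrm{SL}_{|I|}(\gamma)$ for imaginary $\gamma$. Then: (a) $\mathrm{SL}(\alpha_i)=[i]$ for all $i\in\widehat I$, and $\mathrm{SL}(\alpha)=\max C(\alpha)$ for every other $\alpha\in\widehat\Delta^{+,\mathrm{re}}$. (b) For $\alpha\in\widehat\Delta^{+,\mathrm{im}}$,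 the words $\mathrm{SL}_1(\alpha),\dots,\mathrm{SL}_{|I|}(\alpha)$ are the $|I|$ lexicographically largest words of $C(\alpha)$ whose standard bracketings are linearly independent: the elements $\mathsf b[\mathrm{SL}_1(\alpha)],\dots,\mathsf b[\mathrm{SL}_{|I|}(\alpha)]$ are linearly independent, and for each $j$ the word $\mathrm{SL}_j(\alpha)$ is the largest $w\in C(\alpha)$ such that $\mathsf b[w]$ is not in the linear span of $\mathsf b[\mathrm{SL}_1(\alpha)],\dots,\mathsf b[\mathrm{SL}_{j-1}(\alpha)]$. These rules determine the affine standard Lyndon words: any assignment to each $\alpha\in\widehat\Delta^+$ of a set of words (one word for real $\alpha$, and $|I|$ words for imaginary $\alpha$) that satisfies (a) and (b), with $C(\alpha)$ formed from that assignment, assigns to each $\alpha$ the set of affine standard Lyndon words of degree $\alpha$. -/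

import Mathlib

open scoped TensorProduct

noncomputable section

/-! ## Lyndon words and standard Lyndon words

Words in an ordered alphabet `A` are lists; the order `<` on `List A` is the lexicographic order, in
which a proper prefix of a word is smaller than the word. -/

section Words

variable {A : Type*} [LinearOrder A]

/-- A nonempty word is Lyndon if it is smaller than all of its proper suffixes. -/
def IsLyndon (w : List A) : Prop :=
  w ≠ [] ∧ ∀ k, 0 < k → k < w.length → w < w.drop k

/-- The length of the left factor of the costandard factorization of a word of length at least two:
its right factor is the longest proper suffix that is a Lyndon word. -/
def costandardIndex (w : List A) : ℕ :=
  sInf {k | 0 < k ∧ k < w.length ∧ IsLyndon (w.drop k)}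

theorem isLyndon_singleton (a : A) : IsLyndon [a] :=
  ⟨by simp, fun k h0 h1 => by simp at h1; omega⟩

theorem costandardIndex_spec {w : List A} (hw : 2 ≤ w.length) :
    0 < costandardIndex w ∧ costandardIndex w < w.length ∧
      IsLyndon (w.drop (costandardIndex w)) := by
  refine Nat.sInf_mem (s := {k | 0 < k ∧ k < w.length ∧ IsLyndon (w.drop k)})
    ⟨w.length - 1, by omega, by omega, ?_⟩
  have h1 : (w.drop (w.length - 1)).length = 1 := by
    rw [List.length_drop]; omega
  obtain ⟨a, ha⟩ := List.length_eq_one_iff.mp h1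
  rw [ha]
  exact isLyndon_singleton a

/-- The standard bracketing `b[w]`: `b[a] = e a` for a letter `a`, and `b[w] = [b[u], b[v]]` where
`w = u v` is the costandard factorization. It is meant for Lyndon words; other words, on which the
same recursion runs, receive irrelevant values. -/
def stdBracketing {L : Type*} [LieRing L] (e : A → L) : List A → L
  | [] => 0
  | [a] => e a
  | a :: b :: t =>
    ⁅stdBracketing e ((a :: b :: t).take (costandardIndex (a :: b :: t))),
      stdBracketing e ((a :: b :: t).drop (costandardIndex (a :: b :: t)))⁆
termination_by w => w.length
decreasing_by
  · have h := costandardIndex_spec (w := a :: b :: t) (by simp)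
    rw [List.length_take]
    omega
  · have h := costandardIndex_spec (w := a :: b :: t) (by simp)
    rw [List.length_drop]
    omega

/-- A Lyndon word `w` is standard Lyndon, with respect to a complex Lie algebra `L` and elements
`e a` indexed by the alphabet, if `b[w]` is not a linear combination of the `b[m]` for Lyndon words
`m > w`. -/
def IsStdLyndon {L : Type*} [LieRing L] [LieAlgebra ℂ L] (e : A → L) (w : List A) : Prop :=
  IsLyndon w ∧
    stdBracketing e w ∉ Submodule.span ℂ (stdBracketing e '' {m | IsLyndon m ∧ w < m})

end Words

/-! ## The affine Lie algebra and its positive subalgebra -/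

section AffineAlgebra

open LieAlgebra

variable {𝔤 : Type*} [LieRing 𝔤] [LieAlgebra ℂ 𝔤]

theorem neg_lieInvariant {κ : LinearMap.BilinForm ℂ 𝔤} (h : κ.lieInvariant 𝔤) :
    (-κ).lieInvariant 𝔤 := fun x y z => by
  simp [h x y z]

theorem neg_isSymm {κ : LinearMap.BilinForm ℂ 𝔤} (h : κ.IsSymm) : (-κ).IsSymm :=
  ⟨fun x y => by simpa using h.eq x y⟩

/-- The affine Lie algebra `𝔤 ⊗ ℂ[t, t⁻¹] ⊕ ℂ c` with the bracket
`[x tⁿ + a c, y tᵐ + b c] = [x, y] tⁿ⁺ᵐ + n δ_{n,-m} κ(x, y) c`. (The sign of `κ` only accounts for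
Mathlib's convention for the residue pairing, see `affineLieAlgebra_bracket`.) -/
abbrev AffineLieAlgebra (κ : LinearMap.BilinForm ℂ 𝔤) (hκ : κ.lieInvariant 𝔤) (hs : κ.IsSymm) :=
  LieAlgebra.ofTwoCocycle
    (LoopAlgebra.twoCocycleOfBilinear ℂ ℤ 𝔤 (-κ) (neg_lieInvariant hκ) (neg_isSymm hs))

/-- The element `x tⁿ + a c` of the affine Lie algebra. -/
def affineElt (κ : LinearMap.BilinForm ℂ 𝔤) (hκ : κ.lieInvariant 𝔤) (hs : κ.IsSymm)
    (x : 𝔤) (n : ℤ) (a : ℂ) : AffineLieAlgebra κ hκ hs :=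
  LieAlgebra.ofProd _
    (AddMonoidAlgebra.single n 1 ⊗ₜ[ℂ] x,
      (TrivialLieModule.equiv ℂ (loopAlgebra ℂ ℤ 𝔤) ℂ).symm a)

theorem affineLieAlgebra_bracket (κ : LinearMap.BilinForm ℂ 𝔤) (hκ : κ.lieInvariant 𝔤)
    (hs : κ.IsSymm) (x y : 𝔤) (n m : ℤ) (a b : ℂ) :
    ⁅affineElt κ hκ hs x n a, affineElt κ hκ hs y m b⁆ =
      affineElt κ hκ hs ⁅x, y⁆ (n + m) (if n = -m then n * κ x y else 0) := by
  have key : LoopAlgebra.residuePairing ℂ ℤ 𝔤 (-κ) (AddMonoidAlgebra.single n 1 ⊗ₜ[ℂ] x)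
      (AddMonoidAlgebra.single m 1 ⊗ₜ[ℂ] y) = if n = -m then n * κ x y else 0 := by
    rw [LoopAlgebra.residuePairing_apply_apply]
    simp only [LoopAlgebra.toFinsupp_single_tmul]
    rw [Finsupp.sum_single_index (by simp)]
    split_ifs with h
    · subst h
      simp
    · rw [Finsupp.single_eq_of_ne (by omega)]
      simp
  unfold affineElt
  rw [LieAlgebra.bracket_ofTwoCocycle]
  refine congrArg _ (Prod.ext ?_ ?_)
  · simp only [Equiv.symm_apply_apply, LieAlgebra.ExtendScalars.bracket_tmul]
    rw [AddMonoidAlgebra.single_mul_single, one_mul]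
  · simp only [Equiv.symm_apply_apply, trivial_lie_zero, add_zero, sub_zero]
    exact congrArg (TrivialLieModule.equiv ℂ (loopAlgebra ℂ ℤ 𝔤) ℂ).symm key

/-- The nodes of the affine Dynkin diagram, `I ⊔ {0}`. -/
inductive AffineNode (I : Type*)
  | zero : AffineNode I
  | node (i : I) : AffineNode I

/-- The generators `e_i = e_i t⁰` (`i ∈ I`) and `e_0 = f_θ t¹` inside the affine Lie algebra. -/
def affineGen (κ : LinearMap.BilinForm ℂ 𝔤) (hκ : κ.lieInvariant 𝔤) (hs : κ.IsSymm)
    {I : Type*} (e : I → 𝔤) (f : 𝔤) : AffineNode I → AffineLieAlgebra κ hκ hs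
  | .zero => affineElt κ hκ hs f 1 0
  | .node i => affineElt κ hκ hs (e i) 0 0

/-- The positive subalgebra of the affine Lie algebra: the Lie subalgebra generated by
`e_i`, `i ∈ I ⊔ {0}`. -/
def affinePos (κ : LinearMap.BilinForm ℂ 𝔤) (hκ : κ.lieInvariant 𝔤) (hs : κ.IsSymm)
    {I : Type*} (e : I → 𝔤) (f : 𝔤) : LieSubalgebra ℂ (AffineLieAlgebra κ hκ hs) :=
  LieSubalgebra.lieSpan ℂ _ (Set.range (affineGen κ hκ hs e f))

/-- The generators, as elements of the positive subalgebra. -/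
def affinePosGen (κ : LinearMap.BilinForm ℂ 𝔤) (hκ : κ.lieInvariant 𝔤) (hs : κ.IsSymm)
    {I : Type*} (e : I → 𝔤) (f : 𝔤) (i : AffineNode I) : affinePos κ hκ hs e f :=
  ⟨affineGen κ hκ hs e f i, LieSubalgebra.subset_lieSpan ⟨i, rfl⟩⟩

end AffineAlgebra

/-! ## Affine roots, degrees of words, and the generalized Leclerc rules -/

section AffineRoots

open LieAlgebra LieAlgebra.IsKilling

variable {𝔤 : Type*} [LieRing 𝔤] [LieAlgebra ℂ 𝔤] [FiniteDimensional ℂ 𝔤]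
  [LieAlgebra.IsSimple ℂ 𝔤] {H : LieSubalgebra ℂ 𝔤} [H.IsCartanSubalgebra]
  (b : (rootSystem H).Base)

/-- Positive real affine roots: `(β, n)` with `β ∈ Δ⁺`, `n ≥ 0`, or `β ∈ Δ⁻ = -Δ⁺`, `n > 0`. -/
def IsPosReal (p : Module.Dual ℂ H × ℤ) : Prop :=
  ∃ β : H.root, b.IsPos β ∧
    ((p.1 = (rootSystem H).root β ∧ 0 ≤ p.2) ∨ (p.1 = -(rootSystem H).root β ∧ 0 < p.2))

/-- Positive imaginary affine roots `k δ = (0, k)`, `k > 0`. -/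
def IsPosImag (p : Module.Dual ℂ H × ℤ) : Prop :=
  p.1 = 0 ∧ 0 < p.2

/-- Positive affine roots. -/
def IsPosAffineRoot (p : Module.Dual ℂ H × ℤ) : Prop :=
  IsPosReal b p ∨ IsPosImag p

/-- The affine simple roots: `α_i = (α_i, 0)` for `i ∈ I` and `α_0 = (-θ, 1)`. -/
def affineSimpleRoot (θ : H.root) : AffineNode b.support → Module.Dual ℂ H × ℤ
  | .zero => (-(rootSystem H).root θ, 1)
  | .node i => ((rootSystem H).root i, 0)

/-- The degree of a word, the sum of the simple roots attached to its letters. -/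
def wordDegree (θ : H.root) (w : List (AffineNode b.support)) : Module.Dual ℂ H × ℤ :=
  (w.map (affineSimpleRoot b θ)).sum

variable [LinearOrder (AffineNode b.support)] {L : Type*} [LieRing L]

/-- Given a family `S` assigning to each degree a set of words, the concatenations `ℓ₁ ℓ₂` of
`ℓ₁ ∈ S γ₁` and `ℓ₂ ∈ S γ₂`, over all decompositions `α = γ₁ + γ₂` into positive affine roots, such
that `ℓ₁ < ℓ₂` and `[b[ℓ₁], b[ℓ₂]] ≠ 0`. -/
def leclercConcatenations (e : AffineNode b.support → L)
    (S : Module.Dual ℂ H × ℤ → Set (List (AffineNode b.support))) (α : Module.Dual ℂ H × ℤ) :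
    Set (List (AffineNode b.support)) :=
  {w | ∃ γ₁ γ₂, IsPosAffineRoot b γ₁ ∧ IsPosAffineRoot b γ₂ ∧ γ₁ + γ₂ = α ∧
    ∃ ℓ₁ ∈ S γ₁, ∃ ℓ₂ ∈ S γ₂, ℓ₁ < ℓ₂ ∧
      ⁅stdBracketing e ℓ₁, stdBracketing e ℓ₂⁆ ≠ 0 ∧ w = ℓ₁ ++ ℓ₂}

/-- The rules of the generalized Leclerc algorithm for a family `S` of sets of words:
* `S α_i = {[i]}` for the affine simple roots;
* for any other positive real affine root `α`, `S α` consists of one word, the largest of the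
  concatenations in degree `α`;
* for a positive imaginary affine root `α`, `S α` consists of `|I|` words
  `s 0 > s 1 > ⋯ > s (|I| - 1)` with linearly independent standard bracketings, and each `s j` is
  the largest of the concatenations in degree `α` whose standard bracketing is linearly independent
  of those of the preceding `s i`, `i < j`. -/
structure LeclercRules [LieAlgebra ℂ L] (θ : H.root) (e : AffineNode b.support → L)
    (S : Module.Dual ℂ H × ℤ → Set (List (AffineNode b.support))) : Prop where
  simple : ∀ i, S (affineSimpleRoot b θ i) = {[i]}
  real : ∀ α, IsPosReal b α → (∀ i, α ≠ affineSimpleRoot b θ i) →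
    ∃ ℓ, S α = {ℓ} ∧ IsGreatest (leclercConcatenations b e S α) ℓ
  imag : ∀ α, IsPosImag α →
    ∃ s : Fin b.support.card → List (AffineNode b.support),
      StrictAnti s ∧ S α = Set.range s ∧
      LinearIndependent ℂ (fun j => stdBracketing e (s j)) ∧
      ∀ j, IsGreatest
        {w ∈ leclercConcatenations b e S α |
          stdBracketing e w ∉ Submodule.span ℂ ((fun i => stdBracketing e (s i)) '' Set.Iio j)}
        (s j)

/-- The standard Lyndon words of degree `α`. -/
def stdLyndonOfDegree [LieAlgebra ℂ L] (θ : H.root) (e : AffineNode b.support → L)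
    (α : Module.Dual ℂ H × ℤ) : Set (List (AffineNode b.support)) :=
  {w | IsStdLyndon e w ∧ wordDegree b θ w = α}

end AffineRoots

end

/-! The proof separates a statement about Lyndon words in a graded Lie algebra from the computation
of the graded dimensions of the positive subalgebra.

Triangularity carries the first half: for Lyndon `u < v`, expanding `[b[u], b[v]]` by the Jacobi
identity produces only `b[m]` with `m ≥ uv` (`lie_stdBracketing_mem_lyndonSpan`). Hence the
costandard factors of a standard Lyndon word are standard, and the bracketings of the standard
Lyndon words of one degree form a basis of that component, so dimensions count words
(`ncard_isStdLyndon`). A standard Lyndon word with at least two letters is therefore a Leclerc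
concatenation, while a concatenation with nonzero bracket is at most some standard Lyndon word of
its degree (`exists_isStdLyndon_ge`). This gives the maximum in real degrees; in imaginary degrees,
triangularity shows that the greedy choice picks exactly the standard words.

For the second half, the cocycle vanishes on nonnegative powers of `t`, so the components are of the
form `𝔤_β tⁿ`. All of `𝔤 t` is reached because `f_θ` generates the adjoint module under the `e_i`
(`eq_top_of_lowest_mem`), and the higher powers are reached because `𝔤` is perfect. Real degrees
thus have dimension one, and imaginary ones the rank.

Uniqueness is an induction on an additive height that is a positive integer on positive affine
roots: the concatenations in degree `α` only involve words of smaller height. -/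

noncomputable section

/-! ### Combinatorics of Lyndon words and costandard factorization -/

section Words

variable {A : Type*} [LinearOrder A]

theorem List.lt_append_of_ne_nil (u : List A) {v : List A} (hv : v ≠ []) : u < u ++ v := by
  induction u with
  | nil => cases v with
    | nil => exact absurd rfl hv
    | cons a t => simp
  | cons a u ih => simpa [List.cons_lt_cons_iff] using ih

theorem List.append_lt_append_left_iff (u : List A) {v w : List A} :
    u ++ v < u ++ w ↔ v < w := by
  induction u with
  | nil => simp
  | cons a u ih => simpa [List.cons_lt_cons_iff] using ih

/-- The comparison is decided at the first differing letter, before the appended tails are reached.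
-/
theorem List.append_lt_append_of_lt_of_not_prefix {u v : List A} (h : u < v)
    (hp : ¬ u <+: v) (a b : List A) : u ++ a < v ++ b := by
  induction u generalizing v with
  | nil => simp at hp
  | cons x u ih =>
    cases v with
    | nil => simp at h
    | cons y v =>
      simp only [List.cons_append, List.cons_lt_cons_iff] at h ⊢
      rcases h with h | ⟨rfl, h⟩
      · exact Or.inl h
      · exact Or.inr ⟨rfl, ih h fun hp' => hp (by simpa using hp')⟩

theorem List.append_lt_append_of_lt_of_length_le {u v : List A} (h : u < v)
    (hl : v.length ≤ u.length) (a b : List A) : u ++ a < v ++ b :=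
  append_lt_append_of_lt_of_not_prefix h
    (fun hp => h.ne (hp.eq_of_length_le hl)) a b

theorem List.lt_append_of_lt {u v : List A} (h : u < v) (b : List A) : u < v ++ b := by
  by_cases hb : b = []
  · simpa [hb] using h
  · exact h.trans (lt_append_of_ne_nil v hb)

theorem isLyndon_iff {w : List A} :
    IsLyndon w ↔ w ≠ [] ∧ ∀ s t, w = s ++ t → s ≠ [] → t ≠ [] → w < t := by
  refine and_congr_right fun _ => ⟨?_, ?_⟩
  · rintro h s t rfl hs ht
    have := h s.length (List.length_pos_iff.2 hs) (by
      have := List.length_pos_iff.2 ht; rw [List.length_append]; omega)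
    simpa using this
  · intro h k h0 hk
    refine h (w.take k) (w.drop k) (List.take_append_drop k w).symm ?_ ?_
    · rw [← List.length_pos_iff, List.length_take]; omega
    · rw [← List.length_pos_iff, List.length_drop]; omega

theorem IsLyndon.ne_nil {w : List A} (h : IsLyndon w) : w ≠ [] := h.1

theorem IsLyndon.lt_of_append {s t : List A} (h : IsLyndon (s ++ t)) (hs : s ≠ [])
    (ht : t ≠ []) : s ++ t < t :=
  (isLyndon_iff.1 h).2 s t rfl hs ht

/-- The concatenation of two Lyndon words in increasing order is smaller than the second one. -/
theorem append_lt_right_of_isLyndon {u v : List A} (hu : u ≠ []) (hv : IsLyndon v) (h : u < v) :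
    u ++ v < v := by
  by_cases hp : u <+: v
  · obtain ⟨z, rfl⟩ := hp
    have hz : z ≠ [] := by
      rintro rfl
      simp at h
    rw [List.append_lt_append_left_iff]
    exact hv.lt_of_append hu hz
  · simpa using List.append_lt_append_of_lt_of_not_prefix h hp v []

/-- A suffix cut inside `v` is at least `v`, which exceeds `uv`. A cut inside `u` leaves `yv` with
`y > u` and `y` shorter than `u`, so that `u` and `y` already differ at a letter of `y`. -/
theorem IsLyndon.append {u v : List A} (hu : IsLyndon u) (hv : IsLyndon v) (h : u < v) :
    IsLyndon (u ++ v) := by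
  have huv := append_lt_right_of_isLyndon hu.ne_nil hv h
  refine isLyndon_iff.2 ⟨by simp [hu.ne_nil], fun s t hst hs ht => ?_⟩
  rcases List.append_eq_append_iff.1 hst with ⟨y, rfl, hy⟩ | ⟨y, hy, rfl⟩
  · rcases eq_or_ne y [] with rfl | hy0
    · rw [List.nil_append] at hy
      exact hy ▸ huv
    · exact huv.trans (by simpa [hy] using (hy ▸ hv : IsLyndon (y ++ t)).lt_of_append hy0 ht)
  · rcases eq_or_ne y [] with rfl | hy0
    · simpa using huv
    · subst hy
      exact List.append_lt_append_of_lt_of_length_le (hu.lt_of_append hs hy0) (by simp) v v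

/-- The right factor of the costandard factorization of a word is its smallest proper suffix. -/
theorem drop_costandardIndex_le {w : List A} {s t : List A} (h : w = s ++ t)
    (hs : s ≠ []) (ht : t ≠ []) : w.drop (costandardIndex w) ≤ t := by
  have hw : 2 ≤ w.length := by
    have h1 := List.length_pos_iff.2 hs
    have h2 := List.length_pos_iff.2 ht
    rw [h, List.length_append]; omega
  have hspec := costandardIndex_spec hw
  by_contra! hlt
  have hne : (((Finset.Ico 1 w.length).image fun k => w.drop k)).Nonempty := by
    simp; omega
  obtain ⟨m, hm, hmin⟩ := Finset.exists_minimal hne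
  simp only [Finset.mem_image, Finset.mem_Ico] at hm hmin
  obtain ⟨k, ⟨hk1, hk2⟩, rfl⟩ := hm
  have hmin' : ∀ j, 1 ≤ j → j < w.length → w.drop k ≤ w.drop j := by
    intro j h1 h2
    by_contra! hj
    exact hj.not_ge (hmin ⟨j, ⟨h1, h2⟩, rfl⟩ hj.le)
  -- The smallest proper suffix is Lyndon, so the longest Lyndon suffix starts no later. If it
  -- started strictly earlier, being Lyndon would make it even smaller.
  have hL : IsLyndon (w.drop k) := by
    refine ⟨by rw [← List.length_pos_iff, List.length_drop]; omega, fun j hj0 hj => ?_⟩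
    rw [List.length_drop] at hj
    rw [List.drop_drop]
    refine lt_of_le_of_ne (hmin' _ (by omega) (by omega)) fun he => ?_
    have := congrArg List.length he
    simp only [List.length_drop] at this
    omega
  have hle : costandardIndex w ≤ k := Nat.sInf_le ⟨by omega, hk2, hL⟩
  have h3 : w.drop k ≤ t := by
    have := hmin' s.length (List.length_pos_iff.2 hs) (by
      have := List.length_pos_iff.2 ht; rw [h, List.length_append]; omega)
    rwa [h, List.drop_left, ← h] at this
  rcases hle.eq_or_lt with he | hlt'
  · rw [he] at hlt
    exact (hlt.trans_le h3).false
  · have := hspec.2.2.2 (k - costandardIndex w) (by omega) (by rw [List.length_drop]; omega)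
    rw [List.drop_drop, Nat.add_sub_cancel' hle] at this
    exact (this.trans_le (h3.trans hlt.le)).false

section Bracketing

variable {L : Type*} [LieRing L] (e : A → L)

@[simp] theorem stdBracketing_singleton (a : A) : stdBracketing e [a] = e a := by
  rw [stdBracketing]

theorem stdBracketing_of_two_le {w : List A} (hw : 2 ≤ w.length) :
    stdBracketing e w = ⁅stdBracketing e (w.take (costandardIndex w)),
      stdBracketing e (w.drop (costandardIndex w))⁆ := by
  match w, hw with
  | a :: b :: t, _ => rw [stdBracketing]

/-- The costandard factorization of a Lyndon word. -/
theorem IsLyndon.exists_costandard {w : List A} (h : IsLyndon w) (hw : 2 ≤ w.length) :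
    ∃ u v, w = u ++ v ∧ IsLyndon u ∧ IsLyndon v ∧ u < v ∧
      (∀ s t, w = s ++ t → s ≠ [] → t ≠ [] → v ≤ t) ∧
      stdBracketing e w = ⁅stdBracketing e u, stdBracketing e v⁆ := by
  obtain ⟨h0, h1, hv⟩ := costandardIndex_spec hw
  have hmin := fun s t => drop_costandardIndex_le (w := w) (s := s) (t := t)
  have hbr := stdBracketing_of_two_le e hw
  have hcat := (List.take_append_drop (costandardIndex w) w).symm
  have hu0 : w.take (costandardIndex w) ≠ [] := by
    rw [← List.length_pos_iff, List.length_take]; omega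
  generalize w.take (costandardIndex w) = u at *
  generalize w.drop (costandardIndex w) = v at *
  subst hcat
  refine ⟨u, v, rfl, isLyndon_iff.2 ⟨hu0, ?_⟩, hv,
    (List.lt_append_of_ne_nil u hv.ne_nil).trans (h.lt_of_append hu0 hv.ne_nil), hmin, hbr⟩
  rintro s t rfl hs ht
  by_contra! hle
  have hne : t ≠ s ++ t := fun he => by simpa [hs] using congrArg List.length he
  have hlt : t < s ++ t := lt_of_le_of_ne hle hne
  have h2 : (s ++ t) ++ v < t ++ v := by
    simpa only [List.append_assoc] using
      (by simpa only [List.append_assoc] using h : IsLyndon (s ++ (t ++ v))).lt_of_append hs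
        (by simp [ht])
  -- If `u = tz`, cancelling `t` in `h2` gives `zv < v`, against the minimality of `v` among
  -- suffixes. Otherwise `t < u` is decided at a letter, and `tv < uv` contradicts `h2`.
  by_cases hp : t <+: s ++ t
  · obtain ⟨z, hz⟩ := hp
    have hz0 : z ≠ [] := by
      rintro rfl
      exact hne (by simpa using hz)
    rw [← hz, List.append_assoc, List.append_lt_append_left_iff] at h2
    have h3 := hmin t (z ++ v) (by rw [← List.append_assoc, hz]) ht (by simp [hz0])
    exact (h2.trans_le h3).false
  · exact (h2.trans (List.append_lt_append_of_lt_of_not_prefix hlt hp v v)).false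

/-- The hypothesis makes `v` the longest Lyndon proper suffix: a longer one would be `dv` with `d` a
proper suffix of `u`, and then `dv < v ≤ d`, although `d` is a prefix of `dv`. -/
theorem stdBracketing_append {u v : List A} (hu : u ≠ []) (hv : IsLyndon v)
    (h : ∀ s t, u = s ++ t → s ≠ [] → t ≠ [] → v ≤ t) :
    stdBracketing e (u ++ v) = ⁅stdBracketing e u, stdBracketing e v⁆ := by
  have hu' := List.length_pos_iff.2 hu
  have hv' := List.length_pos_iff.2 hv.ne_nil
  have hw : 2 ≤ (u ++ v).length := by rw [List.length_append]; omega
  have hidx : costandardIndex (u ++ v) = u.length := by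
    obtain ⟨h0, h1, hL⟩ := costandardIndex_spec hw
    have hle : costandardIndex (u ++ v) ≤ u.length :=
      Nat.sInf_le ⟨hu', by rw [List.length_append]; omega, by simpa using hv⟩
    refine hle.antisymm (not_lt.1 fun hlt => ?_)
    generalize costandardIndex (u ++ v) = k at *
    rw [List.drop_append_of_le_length hlt.le] at hL
    have hd : u.drop k ≠ [] := by rw [← List.length_pos_iff, List.length_drop]; omega
    have h2 := h (u.take k) (u.drop k) (List.take_append_drop k u).symm
      (by rw [← List.length_pos_iff, List.length_take]; omega) hd
    have h3 := hL.lt_of_append hd hv.ne_nil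
    exact (h3.trans_le h2).not_ge (List.lt_append_of_ne_nil _ hv.ne_nil).le
  rw [stdBracketing_of_two_le e hw, hidx, List.take_left, List.drop_left]

end Bracketing
end Words

/-! ### Triangularity of brackets of Lyndon words -/

section Triangularity

variable {A : Type*} [LinearOrder A] {R L : Type*} [CommRing R] [LieRing L] [LieAlgebra R L]

theorem lie_mem_of_mem_span_left {s : Set L} {N : Submodule R L} {x y : L}
    (hx : x ∈ Submodule.span R s) (h : ∀ z ∈ s, ⁅z, y⁆ ∈ N) : ⁅x, y⁆ ∈ N := by
  induction hx using Submodule.span_induction with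
  | mem z hz => exact h z hz
  | zero => simp
  | add a b _ _ ha hb => rw [add_lie]; exact N.add_mem ha hb
  | smul c a _ ha => rw [smul_lie]; exact N.smul_mem c ha

theorem lie_mem_of_mem_span_right {s : Set L} {N : Submodule R L} {x y : L}
    (hx : x ∈ Submodule.span R s) (h : ∀ z ∈ s, ⁅y, z⁆ ∈ N) : ⁅y, x⁆ ∈ N := by
  rw [← lie_skew, neg_mem_iff]
  refine lie_mem_of_mem_span_left hx fun z hz => ?_
  rw [← lie_skew, neg_mem_iff]
  exact h z hz

/-- The span of the brackets of the Lyndon words of length `n` that are at least `w`. -/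
def lyndonSpan (R : Type*) {L : Type*} [CommRing R] [LieRing L] [LieAlgebra R L] (e : A → L)
    (n : ℕ) (w : List A) : Submodule R L :=
  Submodule.span R (stdBracketing e '' {m | IsLyndon m ∧ w ≤ m ∧ m.length = n})

theorem lyndonSpan_anti (e : A → L) (n : ℕ) {w w' : List A} (h : w ≤ w') :
    lyndonSpan R e n w' ≤ lyndonSpan R e n w :=
  Submodule.span_mono (Set.image_mono fun _ hm => ⟨hm.1, h.trans hm.2.1, hm.2.2⟩)

/-- The bracket of the bracketings of two Lyndon words `u < v` is a linear combination of
bracketings of Lyndon words that are at least `u v`. -/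
theorem lie_stdBracketing_mem_lyndonSpan [Finite A] (e : A → L) {u v : List A}
    (hu : IsLyndon u) (hv : IsLyndon v) (h : u < v) :
    ⁅stdBracketing e u, stdBracketing e v⁆ ∈
      lyndonSpan R e (u.length + v.length) (u ++ v) := by
  -- Three nested inductions: on the total length, downwards on the concatenated word (only finitely
  -- many have a given length), and on the length of the left factor.
  suffices H : ∀ n, ∀ w ∈ {w : List A | w.length = n}, ∀ k, ∀ u v : List A, u.length = k →
      u ++ v = w → IsLyndon u → IsLyndon v → u < v →
      ⁅stdBracketing e u, stdBracketing e v⁆ ∈ lyndonSpan R e n w from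
    H _ (u ++ v) (by simp) _ u v rfl rfl hu hv h
  clear! u v
  intro n
  induction n using Nat.strong_induction_on with
  | _ n ihn =>
  intro w hw
  refine Set.WellFoundedOn.induction (P := fun w => ∀ k, ∀ u v : List A, u.length = k →
      u ++ v = w → IsLyndon u → IsLyndon v → u < v →
      ⁅stdBracketing e u, stdBracketing e v⁆ ∈ lyndonSpan R e n w)
    ((List.finite_length_eq A n).wellFoundedOn (r := (· > ·))) hw ?_
  intro w hw ihw k
  induction k using Nat.strong_induction_on with
  | _ k ihk =>
  rintro u v rfl rfl hu hv huv
  rw [Set.mem_ofPred_eq, List.length_append] at hw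
  by_cases hfac : ∀ s t, u = s ++ t → s ≠ [] → t ≠ [] → v ≤ t
  · rw [← stdBracketing_append e hu.ne_nil hv hfac]
    exact Submodule.subset_span ⟨_, ⟨hu.append hv huv, le_rfl, by simpa using hw⟩, rfl⟩
  have hlen : 2 ≤ u.length := by
    push Not at hfac
    obtain ⟨s, t, rfl, hs, ht, -⟩ := hfac
    have h1 := List.length_pos_iff.2 hs
    have h2 := List.length_pos_iff.2 ht
    rw [List.length_append]; omega
  obtain ⟨p, q, rfl, hp, hq, hpq, hmin, hbr⟩ := hu.exists_costandard e hlen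
  -- Some proper suffix of `u = pq` lies below `v`, and `q` is the smallest one.
  have hqv : q < v := by
    push Not at hfac
    obtain ⟨s, t, hst, hs, ht, hlt⟩ := hfac
    exact (hmin s t hst hs ht).trans_lt hlt
  have hp0 := List.length_pos_iff.2 hp.ne_nil
  have hq0 := List.length_pos_iff.2 hq.ne_nil
  have hv0 := List.length_pos_iff.2 hv.ne_nil
  rw [List.length_append] at hw
  have hpqq : p ++ q < q := hu.lt_of_append hp.ne_nil hq.ne_nil
  -- any pair of Lyndon words whose concatenation is larger is covered by induction
  have key : ∀ a b : List A, IsLyndon a → IsLyndon b → a.length + b.length = n → a < b →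
      p ++ q ++ v < a ++ b →
      ⁅stdBracketing e a, stdBracketing e b⁆ ∈ lyndonSpan R e n (p ++ q ++ v) := by
    intro a b ha hb hab hlt hgt
    exact lyndonSpan_anti e n hgt.le
      (ihw (a ++ b) (by simpa using hab) hgt _ a b rfl rfl ha hb hlt)
  -- Jacobi: `[[p, q], v] = [p, [q, v]] + [[p, v], q]`. The inner brackets are shorter, hence expand
  -- in Lyndon words `m ≥ qv` and `m ≥ pv` respectively.
  rw [hbr, lie_lie, sub_eq_add_neg, lie_skew]
  refine Submodule.add_mem _ ?_ ?_
  · refine lie_mem_of_mem_span_right (ihn (q.length + v.length) (by omega) (q ++ v) (by simp) _ q v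
      rfl rfl hq hv hqv) ?_
    rintro _ ⟨m, ⟨hm, hqm, hml⟩, rfl⟩
    have hpm : p < m := hpq.trans ((List.lt_append_of_ne_nil q hv.ne_nil).trans_le hqm)
    -- For `m = qv` the concatenation is unchanged but the left factor `p` is shorter; for `m > qv`
    -- the concatenation grows.
    rcases hqm.eq_or_lt with rfl | hlt
    · exact ihk p.length (by rw [List.length_append]; omega) p (q ++ v) rfl
        (by rw [List.append_assoc]) hp hm hpm
    · refine key p m hp hm (by omega) hpm ?_
      rw [List.append_assoc, List.append_lt_append_left_iff]
      exact hlt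
  · refine lie_mem_of_mem_span_left (ihn (p.length + v.length) (by omega) (p ++ v) (by simp) _ p v
      rfl rfl hp hv (hpq.trans hqv)) ?_
    rintro _ ⟨m, ⟨hm, hpm, hml⟩, rfl⟩
    -- Since `qv < v`, also `pqv < pv ≤ m`. Thus `mq` exceeds `pqv`, and so does `qm` because `pq <
    -- q`.
    have hmw : p ++ q ++ v < m := by
      refine lt_of_lt_of_le ?_ hpm
      rw [List.append_assoc, List.append_lt_append_left_iff]
      exact append_lt_right_of_isLyndon hq.ne_nil hv hqv
    rcases lt_trichotomy m q with hlt | rfl | hlt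
    · exact key m q hm hq (by omega) hlt (List.lt_append_of_lt hmw q)
    · simp
    · rw [← lie_skew, neg_mem_iff]
      exact key q m hq hm (by omega) hlt
        (List.append_lt_append_of_lt_of_length_le hpqq (by simp) v m)

end Triangularity

/-! ### Standard Lyndon words in a graded Lie algebra -/

section Grading

variable {A : Type*} [LinearOrder A] {L : Type*} [LieRing L] [LieAlgebra ℂ L] {Γ : Type*}

/-- An independent family of subspaces `V γ` of a Lie algebra generated by the `e a`, with a degree
function on words that determines their length, such that bracketings are homogeneous. -/
structure IsWordGrading (e : A → L) (deg : List A → Γ) (V : Γ → Submodule ℂ L) : Prop where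
  indep : iSupIndep V
  mem : ∀ w, stdBracketing e w ∈ V (deg w)
  lie_mem : ∀ u v, ⁅stdBracketing e u, stdBracketing e v⁆ ∈ V (deg (u ++ v))
  length_eq : ∀ u v, deg u = deg v → u.length = v.length
  lieSpan_eq_top : LieSubalgebra.lieSpan ℂ L (Set.range e) = ⊤

variable {e : A → L} {deg : List A → Γ} {V : Γ → Submodule ℂ L}

namespace IsWordGrading

/-- The homogeneous component of a linear combination of bracketings. -/
theorem mem_span_of_mem (hV : IsWordGrading e deg V) {T : Set (List A)} {x : L} {γ : Γ}
    (hx : x ∈ V γ) (h : x ∈ Submodule.span ℂ (stdBracketing e '' T)) :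
    x ∈ Submodule.span ℂ (stdBracketing e '' {m ∈ T | deg m = γ}) := by
  have hT : T = {m ∈ T | deg m = γ} ∪ {m ∈ T | deg m ≠ γ} := by
    ext m
    by_cases hm : deg m = γ <;> simp [hm]
  rw [hT, Set.image_union, Submodule.span_union] at h
  obtain ⟨y, hy, z, hz, rfl⟩ := Submodule.mem_sup.1 h
  have hyV : y ∈ V γ := by
    refine (Submodule.span_le.2 ?_ : Submodule.span ℂ _ ≤ V γ) hy
    rintro _ ⟨m, ⟨-, hm⟩, rfl⟩
    exact hm ▸ hV.mem m
  have hzV : z ∈ V γ := by simpa using (V γ).sub_mem hx hyV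
  have hzV' : z ∈ ⨆ (γ') (_ : γ' ≠ γ), V γ' := by
    refine (Submodule.span_le.2 ?_ : Submodule.span ℂ _ ≤ _) hz
    rintro _ ⟨m, ⟨-, hm⟩, rfl⟩
    exact Submodule.mem_iSup_of_mem (deg m) (Submodule.mem_iSup_of_mem hm (hV.mem m))
  rw [(Submodule.disjoint_def.1 (hV.indep γ)) z hzV hzV', add_zero]
  exact hy

/-- Passing to homogeneous components discards the words of other degrees. The remaining ones have
the length of `w`, which makes downward induction possible. -/
theorem isStdLyndon_iff (hV : IsWordGrading e deg V) {w : List A} :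
    IsStdLyndon e w ↔ IsLyndon w ∧ stdBracketing e w ∉
      Submodule.span ℂ (stdBracketing e '' {m | IsLyndon m ∧ w < m ∧ deg m = deg w}) := by
  refine and_congr_right fun _ => not_congr ⟨fun h => ?_, fun h => ?_⟩
  · refine Submodule.span_mono (Set.image_mono ?_) (hV.mem_span_of_mem (hV.mem w) h)
    rintro m ⟨⟨h1, h2⟩, h3⟩
    exact ⟨h1, h2, h3⟩
  · refine Submodule.span_mono (Set.image_mono ?_) h
    rintro m ⟨h1, h2, -⟩
    exact ⟨h1, h2⟩

variable [Finite A]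

theorem lie_mem_span_of_lt {u v w : List A} (hu : IsLyndon u) (hv : IsLyndon v) (h : u < v)
    (hw : w < u ++ v) : ⁅stdBracketing e u, stdBracketing e v⁆ ∈
      Submodule.span ℂ (stdBracketing e '' {m | IsLyndon m ∧ w < m}) := by
  refine Submodule.span_mono (Set.image_mono ?_) (lie_stdBracketing_mem_lyndonSpan e hu hv h)
  exact fun m hm => ⟨hm.1, hw.trans_le hm.2.1⟩

/-- The factors of the costandard factorization of a standard Lyndon word are standard. -/
theorem exists_factorization (hV : IsWordGrading e deg V) {w : List A} (hw : IsStdLyndon e w)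
    (hl : 2 ≤ w.length) :
    ∃ u v, w = u ++ v ∧ IsStdLyndon e u ∧ IsStdLyndon e v ∧ u < v ∧
      stdBracketing e w = ⁅stdBracketing e u, stdBracketing e v⁆ := by
  obtain ⟨u, v, rfl, hu, hv, huv, -, hbr⟩ := hw.1.exists_costandard e hl
  have hlt := append_lt_right_of_isLyndon hu.ne_nil hv huv
  refine ⟨u, v, rfl, ⟨hu, fun hmem => hw.2 ?_⟩, ⟨hv, fun hmem => hw.2 ?_⟩, huv, hbr⟩
  -- Homogeneity gives `m` the length of `u`, so `m > u` implies `mv > uv`; this could fail if `m`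
  -- properly extended `u`.
  · have hmem' := hV.mem_span_of_mem (hV.mem u) hmem
    rw [hbr]
    refine lie_mem_of_mem_span_left hmem' ?_
    rintro _ ⟨m, ⟨⟨hm, hum⟩, hd⟩, rfl⟩
    rcases lt_trichotomy m v with hlt' | rfl | hlt'
    · exact lie_mem_span_of_lt hm hv hlt' (List.append_lt_append_of_lt_of_length_le hum
        (hV.length_eq _ _ hd).le v v)
    · simp
    · rw [← lie_skew, neg_mem_iff]
      exact lie_mem_span_of_lt hv hm hlt' (List.lt_append_of_lt hlt m)
  · rw [hbr]
    refine lie_mem_of_mem_span_right hmem ?_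
    rintro _ ⟨m, ⟨hm, hvm⟩, rfl⟩
    exact lie_mem_span_of_lt hu hm (huv.trans hvm)
      ((List.append_lt_append_left_iff u).2 hvm)

/-- The bracketing of a Lyndon word is a combination of those of larger standard Lyndon words. -/
theorem mem_span_isStdLyndon (hV : IsWordGrading e deg V) {w : List A} (hw : IsLyndon w) :
    stdBracketing e w ∈ Submodule.span ℂ
      (stdBracketing e '' {m | IsStdLyndon e m ∧ w ≤ m ∧ deg m = deg w}) := by
  refine Set.WellFoundedOn.induction (P := fun w => IsLyndon w → stdBracketing e w ∈
      Submodule.span ℂ (stdBracketing e '' {m | IsStdLyndon e m ∧ w ≤ m ∧ deg m = deg w}))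
    ((List.finite_length_eq A w.length).wellFoundedOn (r := (· > ·))) rfl ?_ hw
  intro v hv ih hvL
  by_cases hstd : IsStdLyndon e v
  · exact Submodule.subset_span ⟨v, ⟨hstd, le_rfl, rfl⟩, rfl⟩
  rw [hV.isStdLyndon_iff, not_and, not_not] at hstd
  refine Submodule.span_le.2 ?_ (hstd hvL)
  rintro _ ⟨m, ⟨hm, hvm, hd⟩, rfl⟩
  refine Submodule.span_mono (Set.image_mono ?_)
    (ih m ((hV.length_eq _ _ hd).trans hv) hvm hm)
  exact fun k hk => ⟨hk.1, hvm.le.trans hk.2.1, hk.2.2.trans hd⟩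

/-- The bracket expands in Lyndon words `≥ uv`, and these in standard ones that are no smaller; were
there none, it would vanish. This is the upper bound behind `max C(α)`. -/
theorem exists_isStdLyndon_ge (hV : IsWordGrading e deg V) {u v : List A} (hu : IsLyndon u)
    (hv : IsLyndon v) (h : u < v) (h0 : ⁅stdBracketing e u, stdBracketing e v⁆ ≠ 0) :
    ∃ m, IsStdLyndon e m ∧ deg m = deg (u ++ v) ∧ u ++ v ≤ m := by
  by_contra! hcon
  refine h0 ?_
  have h1 := hV.mem_span_of_mem (hV.lie_mem u v)
    (lie_stdBracketing_mem_lyndonSpan (R := ℂ) e hu hv h)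
  rw [← Submodule.mem_bot ℂ]
  refine (Submodule.span_le.2 ?_ : Submodule.span ℂ _ ≤ _) h1
  rintro _ ⟨m, ⟨⟨hm, hum, -⟩, hd⟩, rfl⟩
  have h2 := hV.mem_span_isStdLyndon hm
  have h3 : {k | IsStdLyndon e k ∧ m ≤ k ∧ deg k = deg m} = ∅ := by
    refine Set.eq_empty_of_forall_notMem fun k hk => ?_
    exact (hcon k hk.1 (hk.2.2.trans hd)).not_ge (hum.trans hk.2.1)
  simpa [h3] using h2

/-- By triangularity the span is closed under the bracket, and it contains the generators. -/
theorem span_isLyndon_eq_top (hV : IsWordGrading e deg V) :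
    Submodule.span ℂ (stdBracketing e '' {m | IsLyndon m}) = ⊤ := by
  set S := Submodule.span ℂ (stdBracketing e '' {m | IsLyndon m}) with hS
  have hlie : ∀ x ∈ S, ∀ y ∈ S, ⁅x, y⁆ ∈ S := by
    intro x hx y hy
    refine lie_mem_of_mem_span_left hx ?_
    rintro _ ⟨u, hu, rfl⟩
    refine lie_mem_of_mem_span_right hy ?_
    rintro _ ⟨v, hv, rfl⟩
    have key : ∀ u v : List A, IsLyndon u → IsLyndon v → u < v →
        ⁅stdBracketing e u, stdBracketing e v⁆ ∈ S := fun u v hu hv huv =>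
      Submodule.span_mono (Set.image_mono fun m hm => hm.1)
        (lie_stdBracketing_mem_lyndonSpan e hu hv huv)
    rcases lt_trichotomy u v with h | rfl | h
    · exact key u v hu hv h
    · simp
    · rw [← lie_skew, neg_mem_iff]
      exact key v u hv hu h
  let S' : LieSubalgebra ℂ L := { S with lie_mem' := fun {x y} hx hy => hlie x hx y hy }
  have hle : LieSubalgebra.lieSpan ℂ L (Set.range e) ≤ S' := by
    rw [LieSubalgebra.lieSpan_le]
    rintro _ ⟨a, rfl⟩
    exact Submodule.subset_span ⟨[a], isLyndon_singleton a, by simp⟩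
  rw [hV.lieSpan_eq_top] at hle
  exact eq_top_iff.2 fun x _ => hle (x := x) (by simp)

theorem span_isStdLyndon (hV : IsWordGrading e deg V) (γ : Γ) :
    Submodule.span ℂ (stdBracketing e '' {m | IsStdLyndon e m ∧ deg m = γ}) = V γ := by
  refine le_antisymm (Submodule.span_le.2 ?_) fun x hx => ?_
  · rintro _ ⟨m, ⟨-, hm⟩, rfl⟩
    exact hm ▸ hV.mem m
  · have h := hV.mem_span_of_mem hx (hV.span_isLyndon_eq_top ▸ Submodule.mem_top)
    refine (Submodule.span_le.2 ?_ : Submodule.span ℂ _ ≤ _) h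
    rintro _ ⟨m, ⟨hm, hd⟩, rfl⟩
    refine Submodule.span_mono (Set.image_mono ?_) (hV.mem_span_isStdLyndon hm)
    exact fun k hk => ⟨hk.1, hk.2.2.trans hd⟩

omit [Finite A] in
-- In a nontrivial relation, the smallest word with nonzero coefficient would be a combination of
-- larger ones.
theorem linearIndependent_isStdLyndon {T : Set (List A)} (hT : ∀ m ∈ T, IsStdLyndon e m) :
    LinearIndependent ℂ fun m : T => stdBracketing e m := by
  rw [linearIndependent_iff']
  intro s g hg
  by_contra! hne
  obtain ⟨i, hi, hmin⟩ := Finset.exists_minimal (s := s.filter fun i => g i ≠ 0)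
    (by obtain ⟨i, hi, h⟩ := hne; exact ⟨i, by simp [hi, h]⟩)
  rw [Finset.mem_filter] at hi
  refine (hT i i.2).2 ?_
  have h1 : g i • stdBracketing e i = -∑ j ∈ s.erase i, g j • stdBracketing e j := by
    rw [eq_neg_iff_add_eq_zero, Finset.add_sum_erase s (fun j => g j • stdBracketing e j) hi.1, hg]
  rw [← Submodule.smul_mem_iff _ hi.2, h1, neg_mem_iff]
  refine Submodule.sum_mem _ fun j hj => ?_
  by_cases hj0 : g j = 0
  · simp [hj0]
  rw [Finset.mem_erase] at hj
  refine Submodule.smul_mem _ _ (Submodule.subset_span ⟨j, ⟨(hT j j.2).1, ?_⟩, rfl⟩)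
  refine lt_of_not_ge fun hle => hj.1 (le_antisymm hle ?_)
  exact hmin (by simp [hj.2, hj0]) hle

theorem finite_isStdLyndon (hV : IsWordGrading e deg V) (γ : Γ) :
    {m | IsStdLyndon e m ∧ deg m = γ}.Finite := by
  rcases Set.eq_empty_or_nonempty {m | IsStdLyndon e m ∧ deg m = γ} with h | ⟨w, hw⟩
  · rw [h]; exact Set.finite_empty
  · exact (List.finite_length_eq A w.length).subset fun m hm =>
      hV.length_eq _ _ (hm.2.trans hw.2.symm)

theorem ncard_isStdLyndon (hV : IsWordGrading e deg V) (γ : Γ) :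
    {m | IsStdLyndon e m ∧ deg m = γ}.ncard = Module.finrank ℂ (V γ) := by
  have := (hV.finite_isStdLyndon γ).fintype
  have hli := linearIndependent_isStdLyndon (e := e)
    (T := {m | IsStdLyndon e m ∧ deg m = γ}) fun m hm => hm.1
  rw [← hV.span_isStdLyndon γ, Set.image_eq_range, finrank_span_eq_card hli,
    ← Nat.card_coe_set_eq, Nat.card_eq_fintype_card]

end IsWordGrading
end Grading

/-! ### Root spaces and generation of a simple Lie algebra -/

section RootSpaces

open LieAlgebra LieAlgebra.IsKilling LieModule Module

variable {𝔤 : Type*} [LieRing 𝔤] [LieAlgebra ℂ 𝔤] [FiniteDimensional ℂ 𝔤]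
  [LieAlgebra.IsSimple ℂ 𝔤] {H : LieSubalgebra ℂ 𝔤} [H.IsCartanSubalgebra]

theorem finrank_rootSpace_root (β : H.root) :
    finrank ℂ (rootSpace H ((rootSystem H).root β)) = 1 :=
  finrank_rootSpace_eq_one β.1 (LieSubalgebra.isNonZero_coe_root β)

theorem exists_root_of_rootSpace_ne_bot {γ : Dual ℂ H} (h : rootSpace H γ ≠ ⊥) (h0 : γ ≠ 0) :
    ∃ β : H.root, (rootSystem H).root β = γ := by
  have hw : (⟨γ, h⟩ : Weight ℂ H 𝔤).IsNonZero := fun hz =>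
    h0 (LinearMap.ext fun x => congrFun hz x)
  exact ⟨⟨⟨γ, h⟩, by simpa using hw⟩, by ext; rfl⟩

omit [LieAlgebra.IsSimple ℂ 𝔤] in
theorem mem_cartan_of_mem_rootSpace_zero {x : 𝔤}
    (hx : x ∈ rootSpace H ((0 : Dual ℂ H) : H → ℂ)) : x ∈ H := by
  have h0 : ((0 : Dual ℂ H) : H → ℂ) = 0 := rfl
  rw [h0, rootSpace_zero_eq] at hx
  simpa using hx

theorem root_indexNeg (i : H.root) :
    letI := (rootSystem H).indexNeg
    (rootSystem H).root (-i) = -(rootSystem H).root i :=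
  ((rootSystem H).root_reflectionPerm i i).trans ((rootSystem H).reflection_apply_self i)

theorem exists_smul_eq_of_mem_rootSpace (β : H.root) {x y : 𝔤}
    (hx : x ∈ rootSpace H ((rootSystem H).root β)) (hx0 : x ≠ 0)
    (hy : y ∈ rootSpace H ((rootSystem H).root β)) : ∃ c : ℂ, c • x = y := by
  obtain ⟨c, hc⟩ := (finrank_eq_one_iff_of_nonzero' (K := ℂ)
    (⟨x, hx⟩ : rootSpace H ((rootSystem H).root β)) (fun h => hx0 (congrArg Subtype.val h))).1
    (finrank_rootSpace_root β) ⟨y, hy⟩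
  exact ⟨c, congrArg Subtype.val hc⟩

omit [FiniteDimensional ℂ 𝔤] [LieAlgebra.IsSimple ℂ 𝔤] in
theorem lie_mem_rootSpace_add {γ₁ γ₂ : Dual ℂ H} {x y : 𝔤} (hx : x ∈ rootSpace H γ₁)
    (hy : y ∈ rootSpace H γ₂) : ⁅x, y⁆ ∈ rootSpace H (γ₁ + γ₂ : Dual ℂ H) :=
  lie_mem_genWeightSpace_of_mem_genWeightSpace hx hy

/-- If `α`, `β` and `α + β` are roots, the bracket of nonzero root vectors for `α` and `β` is
nonzero. -/
theorem lie_ne_zero_of_root_add {α β γ : H.root}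
    (h : (rootSystem H).root γ = (rootSystem H).root α + (rootSystem H).root β) {x y : 𝔤}
    (hx : x ∈ rootSpace H ((rootSystem H).root α)) (hx0 : x ≠ 0)
    (hy : y ∈ rootSpace H ((rootSystem H).root β)) (hy0 : y ≠ 0) : ⁅x, y⁆ ≠ 0 := by
  have hα := LieSubalgebra.isNonZero_coe_root α
  have htop : 1 ≤ chainTopCoeff α.1 β.1 := by
    have h1 : rootSpace H ((1 : ℤ) • (α.1 : H → ℂ) + β.1) ≠ ⊥ := by
      have : ((1 : ℤ) • (α.1 : H → ℂ) + β.1) = γ.1 := by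
        rw [one_smul]
        ext z
        exact (LinearMap.congr_fun h z).symm
      rw [this]
      exact γ.1.genWeightSpace_ne_bot
    have := ((rootSpace_zsmul_add_ne_bot_iff α.1 β.1 hα 1).1 h1).1
    exact_mod_cast this
  -- The `β` root space lies `p + 1` steps below the top `v` of the `α`-string, so `y` is a multiple
  -- of `f^(p+1) v`. By `sl₂` theory `e f^(p+1) v = (p + 1)(N - p) f^p v`, where `N` is the chain
  -- length and `p < N`.
  obtain ⟨p, hp⟩ : ∃ p, chainTopCoeff α.1 β.1 = p + 1 := ⟨_, (Nat.sub_add_cancel htop).symm⟩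
  have hpN := chainTopCoeff_le_chainLength α.1 β.1
  obtain ⟨v, hv, hv0⟩ := (chainTop α.1 β.1).exists_ne_zero
  obtain ⟨h', e, f, isSl2, he, hf⟩ := exists_isSl2Triple_of_weight_isNonZero hα
  obtain rfl := isSl2.h_eq_coroot hα he hf
  have prim : isSl2.HasPrimitiveVectorWith v (chainLength α.1 β.1 : ℂ) :=
    have := lie_mem_genWeightSpace_of_mem_genWeightSpace he hv
    ⟨hv0, (chainLength_smul _ _ hv).symm, by rwa [genWeightSpace_add_chainTop _ _ hα] at this⟩
  have hw := toEnd_pow_apply_mem hf hv (p + 1)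
  have hw0 := prim.pow_toEnd_f_ne_zero_of_eq_nat rfl (i := p + 1) (by omega)
  have hu0 := prim.pow_toEnd_f_ne_zero_of_eq_nat rfl (i := p) (by omega)
  have hew := prim.lie_e_pow_succ_toEnd_f p
  have hw' : ((toEnd ℂ 𝔤 𝔤 f) ^ (p + 1)) v ∈ rootSpace H ((rootSystem H).root β) := by
    convert hw using 2
    rw [coe_chainTop, hp]
    ext z
    simp
  obtain ⟨c, rfl⟩ := exists_smul_eq_of_mem_rootSpace β hw' hw0 hy
  obtain ⟨d, rfl⟩ := exists_smul_eq_of_mem_rootSpace α he isSl2.e_ne_zero hx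
  rw [smul_lie, lie_smul, hew]
  simp only [ne_eq, smul_eq_zero, not_or] at hx0 hy0 ⊢
  refine ⟨hx0.1, hy0.1, ?_, hu0⟩
  rw [mul_eq_zero, not_or]
  refine ⟨by exact_mod_cast p.succ_ne_zero, sub_ne_zero.2 ?_⟩
  norm_cast
  omega

variable (b : (rootSystem H).Base)

/-- The root spaces of the positive roots are generated by those of the simple roots. -/
theorem rootSpace_le_of_isPos {K : LieSubalgebra ℂ 𝔤}
    (hK : ∀ i ∈ b.support, (rootSpace H ((rootSystem H).root i) : Submodule ℂ 𝔤) ≤ K.toSubmodule)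
    {β : H.root} (hβ : b.IsPos β) :
    (rootSpace H ((rootSystem H).root β) : Submodule ℂ 𝔤) ≤ K.toSubmodule := by
  refine hβ.induction_on_add hK fun i j k hk hi hj => ?_
  obtain ⟨x, hx, hx0⟩ := i.1.exists_ne_zero
  obtain ⟨y, hy, hy0⟩ := j.1.exists_ne_zero
  have hxy := lie_mem_rootSpace_add (γ₁ := (rootSystem H).root i)
    (γ₂ := (rootSystem H).root j) hx hy
  rw [← hk] at hxy
  intro z hz
  obtain ⟨c, rfl⟩ := exists_smul_eq_of_mem_rootSpace k hxy
    (lie_ne_zero_of_root_add hk hx hx0 hy hy0) hz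
  exact K.smul_mem c (K.lie_mem (hi hx) (hK j hj hy))

theorem rootSpace_neg_le_of_isPos {K : LieSubalgebra ℂ 𝔤}
    (hK : ∀ i ∈ b.support,
      (rootSpace H (-(rootSystem H).root i : Dual ℂ H) : Submodule ℂ 𝔤) ≤ K.toSubmodule)
    {β : H.root} (hβ : b.IsPos β) :
    (rootSpace H (-(rootSystem H).root β : Dual ℂ H) : Submodule ℂ 𝔤) ≤ K.toSubmodule := by
  let := (rootSystem H).indexNeg
  have hneg : ∀ i : H.root, (rootSystem H).root (-i) = -(rootSystem H).root i := root_indexNeg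
  refine hβ.induction_on_add hK fun i j k hk hi hj => ?_
  obtain ⟨x, hx, hx0⟩ := (-i).1.exists_ne_zero
  obtain ⟨y, hy, hy0⟩ := (-j).1.exists_ne_zero
  have hk' : (rootSystem H).root (-k) = (rootSystem H).root (-i) + (rootSystem H).root (-j) := by
    rw [hneg, hneg, hneg, hk, neg_add]
  have hxy := lie_mem_rootSpace_add (γ₁ := (rootSystem H).root (-i))
    (γ₂ := (rootSystem H).root (-j)) hx hy
  rw [← hk'] at hxy
  intro z hz
  rw [← hneg] at hz
  obtain ⟨c, rfl⟩ := exists_smul_eq_of_mem_rootSpace (-k) hxy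
    (lie_ne_zero_of_root_add hk' hx hx0 hy hy0) hz
  rw [← hneg] at hi
  exact K.smul_mem c (K.lie_mem (hi hx) (hK j hj (by rw [← hneg]; exact hy)))

theorem iSup_rootSpace_eq_top {K : Submodule ℂ 𝔤} (hH : H.toSubmodule ≤ K)
    (hK : ∀ β : H.root, (rootSpace H ((rootSystem H).root β) : Submodule ℂ 𝔤) ≤ K) : K = ⊤ := by
  have h := congrArg LieSubmodule.toSubmodule
    (cartan_sup_iSup_rootSpace_eq_top (K := ℂ) (L := 𝔤) (H := H))
  rw [eq_top_iff, ← LieSubmodule.top_toSubmodule (R := ℂ) (L := H), ← h]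
  simp only [LieSubmodule.sup_toSubmodule, LieSubmodule.iSup_toSubmodule]
  refine sup_le hH (iSup₂_le fun α hα => hK ⟨α, by simpa using hα⟩)

theorem eq_top_of_simple_rootSpaces_le {K : LieSubalgebra ℂ 𝔤} (hH : H ≤ K)
    (hK : ∀ i ∈ b.support, (rootSpace H ((rootSystem H).root i) : Submodule ℂ 𝔤) ≤ K.toSubmodule)
    (hK' : ∀ i ∈ b.support,
      (rootSpace H (-(rootSystem H).root i : Dual ℂ H) : Submodule ℂ 𝔤) ≤ K.toSubmodule) :
    K = ⊤ := by
  let := (rootSystem H).indexNeg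
  rw [← LieSubalgebra.toSubmodule_inj, LieSubalgebra.top_toSubmodule]
  refine iSup_rootSpace_eq_top hH fun β => ?_
  rcases RootPairing.Base.IsPos.or_neg b β with h | h
  · exact rootSpace_le_of_isPos b hK h
  · have := rootSpace_neg_le_of_isPos b hK' h
    rwa [root_indexNeg, neg_neg] at this

/-- If `θ` were negative, `-θ` would have larger height. -/
theorem isPos_highestRoot {θ : H.root} (hθ : ∀ β : H.root, b.height β ≤ b.height θ) :
    b.IsPos θ := by
  let := (rootSystem H).indexNeg
  rcases RootPairing.Base.IsPos.or_neg b θ with h | h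
  · exact h
  · have h1 := hθ (-θ)
    rw [RootPairing.Base.isPos_iff] at *
    rw [RootPairing.Base.height_reflectionPerm_self] at *
    omega

/-- The adjoint representation of a simple Lie algebra is generated by a lowest root vector under
the action of the positive simple root vectors. -/
theorem eq_top_of_lowest_mem {θ : H.root} (hθ : ∀ β : H.root, b.height β ≤ b.height θ)
    {e : b.support → 𝔤} (he : ∀ i : b.support,
      e i ∈ rootSpace H ((rootSystem H).root i) ∧ e i ≠ 0)
    {f : 𝔤} (hf : f ∈ rootSpace H (-(rootSystem H).root θ) ∧ f ≠ 0)
    {W : Submodule ℂ 𝔤} (hfW : f ∈ W) (hW : ∀ i, ∀ x ∈ W, ⁅e i, x⁆ ∈ W) : W = ⊤ := by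
  let := (rootSystem H).indexNeg
  -- `M` is the smallest subspace containing `f` and stable under the `e_i`. By minimality it lies
  -- in the subspace `N` of vectors that Cartan elements and simple negative root vectors keep in
  -- `M`. Its stabilizer is then all of `𝔤`, and `M` is a nonzero ideal.
  set M : Submodule ℂ 𝔤 := sInf {W | f ∈ W ∧ ∀ i, ∀ x ∈ W, ⁅e i, x⁆ ∈ W} with hM
  have hfM : f ∈ M := by
    rw [hM, Submodule.mem_sInf]
    exact fun W hW => hW.1
  have heM : ∀ i, ∀ x ∈ M, ⁅e i, x⁆ ∈ M := by
    intro i x hx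
    rw [hM, Submodule.mem_sInf] at hx ⊢
    exact fun W hW => hW.2 i x (hx W hW)
  have hMW : M ≤ W := sInf_le ⟨hfW, hW⟩
  suffices M = ⊤ by rwa [this, top_le_iff] at hMW
  let B : Set 𝔤 :=
    {y | y ∈ H ∨ ∃ i : b.support, y ∈ rootSpace H (-(rootSystem H).root i : Dual ℂ H)}
  let N : Submodule ℂ 𝔤 :=
    { carrier := {x | x ∈ M ∧ ∀ y ∈ B, ⁅y, x⁆ ∈ M}
      add_mem' := fun {x x'} hx hx' => ⟨M.add_mem hx.1 hx'.1, fun y hy => by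
        rw [lie_add]; exact M.add_mem (hx.2 y hy) (hx'.2 y hy)⟩
      zero_mem' := ⟨M.zero_mem, fun y _ => by simp⟩
      smul_mem' := fun c x hx => ⟨M.smul_mem c hx.1, fun y hy => by
        rw [lie_smul]; exact M.smul_mem c (hx.2 y hy)⟩ }
  have hcartan : ∀ γ : Dual ℂ H, ∀ x ∈ rootSpace H γ, ∀ h ∈ H, ∃ c : ℂ, ⁅h, x⁆ = c • x :=
    fun γ x hx h hh => ⟨γ ⟨h, hh⟩, lie_eq_smul_of_mem_rootSpace hx ⟨h, hh⟩⟩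
  have hfN : f ∈ N := by
    refine ⟨hfM, fun y hy => ?_⟩
    rcases hy with hy | ⟨i, hy⟩
    · obtain ⟨c, hc⟩ := hcartan (-(rootSystem H).root θ) f hf.1 y hy
      rw [hc]
      exact M.smul_mem c hfM
    · have hyf := lie_mem_rootSpace_add (γ₂ := -(rootSystem H).root θ) hy hf.1
      -- If `-α_i - θ` were zero, `θ` would be negative; if it were a root, `θ + α_i` would be a
      -- root higher than `θ`.
      have hbot : rootSpace H (-(rootSystem H).root i + -(rootSystem H).root θ : Dual ℂ H) = ⊥ := by
        by_contra hne
        have hpos := isPos_highestRoot b hθ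
        have hi := b.height_one_of_mem_support i.2
        by_cases h0 : -(rootSystem H).root i + -(rootSystem H).root θ = 0
        · have h1 : (rootSystem H).root θ = (rootSystem H).root (-i.1) := by
            rw [root_indexNeg]
            rw [← neg_add, neg_eq_zero] at h0
            exact eq_neg_of_add_eq_zero_right h0
          rw [(rootSystem H).root.injective h1, RootPairing.Base.isPos_iff,
            RootPairing.Base.height_reflectionPerm_self] at hpos
          omega
        · obtain ⟨β, hβ⟩ := exists_root_of_rootSpace_ne_bot hne h0
          have h1 : (rootSystem H).root (-β) = (rootSystem H).root θ + (rootSystem H).root i := by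
            rw [root_indexNeg, hβ]
            abel
          have h2 := b.height_add h1
          have h3 := hθ (-β)
          omega
      rw [hbot, LieSubmodule.mem_bot] at hyf
      rw [hyf]
      exact M.zero_mem
  have heN : ∀ j, ∀ x ∈ N, ⁅e j, x⁆ ∈ N := by
    intro j x hx
    refine ⟨heM j x hx.1, fun y hy => ?_⟩
    rw [leibniz_lie]
    refine M.add_mem ?_ (heM j _ (hx.2 y hy))
    rcases hy with hy | ⟨i, hy⟩
    · obtain ⟨c, hc⟩ := hcartan _ (e j) (he j).1 y hy
      rw [hc, smul_lie]
      exact M.smul_mem c (heM j x hx.1)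
    · refine hx.2 _ (Or.inl ?_)
      have hye := lie_mem_rootSpace_add hy (he j).1
      by_cases h0 : -(rootSystem H).root i + (rootSystem H).root j = 0
      · rw [h0] at hye
        exact mem_cartan_of_mem_rootSpace_zero hye
      -- A difference of two simple roots is never a root.
      · have hbot : rootSpace H (-(rootSystem H).root i + (rootSystem H).root j : Dual ℂ H) =
            ⊥ := by
          by_contra hne
          obtain ⟨β, hβ⟩ := exists_root_of_rootSpace_ne_bot hne h0
          exact b.sub_notMem_range_root j.2 i.2 ⟨β, by rw [hβ]; abel⟩
        rw [hbot, LieSubmodule.mem_bot] at hye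
        rw [hye]
        exact H.zero_mem
  have hMN : M ≤ N := sInf_le ⟨hfN, heN⟩
  let K : LieSubalgebra ℂ 𝔤 :=
    { carrier := {y | ∀ x ∈ M, ⁅y, x⁆ ∈ M}
      add_mem' := fun {y y'} hy hy' x hx => by
        rw [add_lie]; exact M.add_mem (hy x hx) (hy' x hx)
      zero_mem' := fun x _ => by simp
      smul_mem' := fun c y hy x hx => by
        rw [smul_lie]; exact M.smul_mem c (hy x hx)
      lie_mem' := fun {y y'} hy hy' x hx => by
        rw [lie_lie]; exact M.sub_mem (hy _ (hy' x hx)) (hy' _ (hy x hx)) }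
  have hK : K = ⊤ := by
    refine eq_top_of_simple_rootSpaces_le b (fun y hy x hx => (hMN hx).2 y (Or.inl hy)) ?_ ?_
    · intro i hi y hy x hx
      obtain ⟨c, rfl⟩ := exists_smul_eq_of_mem_rootSpace i (he ⟨i, hi⟩).1 (he ⟨i, hi⟩).2 hy
      rw [smul_lie]
      exact M.smul_mem c (heM _ x hx)
    · exact fun i hi y hy x hx => (hMN hx).2 y (Or.inr ⟨⟨i, hi⟩, hy⟩)
  let I : LieIdeal ℂ 𝔤 := { M with
    lie_mem := fun {y x} hx => (hK ▸ LieSubalgebra.mem_top y : y ∈ K) x hx }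
  rcases LieAlgebra.IsSimple.eq_bot_or_eq_top (R := ℂ) I with h | h
  · exact absurd ((LieSubmodule.mem_bot f).1 (h ▸ (show f ∈ I from hfM))) hf.2
  · exact congrArg LieSubmodule.toSubmodule h

omit [FiniteDimensional ℂ 𝔤] in
-- The derived ideal is nonzero because `𝔤` is not abelian, hence it is everything.
theorem span_lie_eq_top : Submodule.span ℂ {z : 𝔤 | ∃ x y : 𝔤, ⁅x, y⁆ = z} = ⊤ := by
  have h : (⁅(⊤ : LieIdeal ℂ 𝔤), (⊤ : LieIdeal ℂ 𝔤)⁆ : LieIdeal ℂ 𝔤) = ⊤ := by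
    refine (LieAlgebra.IsSimple.eq_bot_or_eq_top (R := ℂ) _).resolve_left fun h => ?_
    refine LieAlgebra.IsSimple.non_abelian ℂ (L := 𝔤) ⟨fun x y => ?_⟩
    have := LieSubmodule.lie_mem_lie (LieSubmodule.mem_top (R := ℂ) (L := 𝔤) x)
      (LieSubmodule.mem_top (R := ℂ) (L := 𝔤) y)
    rwa [h, LieSubmodule.mem_bot] at this
  have h2 := congrArg LieSubmodule.toSubmodule h
  rw [LieSubmodule.lieIdeal_oper_eq_linear_span'] at h2
  simpa using h2

end RootSpaces

/-! ### Grading of the positive subalgebra and its dimensions -/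

section AffineGrading

open LieAlgebra LieAlgebra.IsKilling LieModule Module

variable {𝔤 : Type*} [LieRing 𝔤] [LieAlgebra ℂ 𝔤] {𝔞 : Type*} [LieRing 𝔞] [LieAlgebra ℂ 𝔞]

/-- Maps `x ↦ x tⁿ` from `𝔤` to a Lie algebra, and the coefficient maps in the opposite direction,
compatible with the bracket for nonnegative powers of `t`. -/
structure IsLoopEmbedding (ε : ℤ → 𝔤 →ₗ[ℂ] 𝔞) (coeff : ℤ → 𝔞 →ₗ[ℂ] 𝔤) : Prop where
  coeff_apply : ∀ n m x, coeff n (ε m x) = if m = n then x else 0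
  lie_apply : ∀ n m x y, 0 ≤ n → 0 ≤ m → ⁅ε n x, ε m y⁆ = ε (n + m) ⁅x, y⁆

variable {ε : ℤ → 𝔤 →ₗ[ℂ] 𝔞} {coeff : ℤ → 𝔞 →ₗ[ℂ] 𝔤}

theorem IsLoopEmbedding.injective (hε : IsLoopEmbedding ε coeff) (n : ℤ) :
    Function.Injective (ε n) := by
  intro x y h
  simpa [hε.coeff_apply] using congrArg (coeff n) h

theorem lieSpan_range_eq_top {R L ι : Type*} [CommRing R] [LieRing L] [LieAlgebra R L]
    {P : LieSubalgebra R L} {g : ι → L} (hP : P = LieSubalgebra.lieSpan R L (Set.range g))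
    {g' : ι → P} (hg : ∀ i, (g' i : L) = g i) :
    LieSubalgebra.lieSpan R P (Set.range g') = ⊤ := by
  set K := LieSubalgebra.lieSpan R P (Set.range g')
  have h : P ≤ K.map P.incl := by
    refine hP.le.trans (LieSubalgebra.lieSpan_le.2 ?_)
    rintro _ ⟨i, rfl⟩
    exact ⟨g' i, LieSubalgebra.subset_lieSpan ⟨i, rfl⟩, hg i⟩
  refine eq_top_iff.2 fun x _ => ?_
  obtain ⟨y, hy, hyx⟩ := h x.2
  obtain rfl : y = x := Subtype.ext hyx
  exact hy

variable [FiniteDimensional ℂ 𝔤] [LieAlgebra.IsSimple ℂ 𝔤] {H : LieSubalgebra ℂ 𝔤}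
  [H.IsCartanSubalgebra]

section Component

variable (ε) (P : LieSubalgebra ℂ 𝔞) (H)

/-- The component `𝔤_β tⁿ` of degree `(β, n)`, `n ≥ 0`, of the positive subalgebra. -/
def affineComponent (γ : Dual ℂ H × ℤ) : Submodule ℂ P :=
  -- Negative powers are excluded because the loop bracket formula is only assumed for nonnegative
  -- ones.
  if 0 ≤ γ.2 then
    ((rootSpace H γ.1 : Submodule ℂ 𝔤).map (ε γ.2)).comap P.toSubmodule.subtype
  else ⊥

variable {ε P H} (hε : IsLoopEmbedding ε coeff)

omit [FiniteDimensional ℂ 𝔤] [LieAlgebra.IsSimple ℂ 𝔤] in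
theorem mem_affineComponent {γ : Dual ℂ H × ℤ} (hγ : 0 ≤ γ.2) {x : 𝔤}
    (hx : x ∈ rootSpace H γ.1) {y : P}
    (hy : (y : 𝔞) = ε γ.2 x) :
    y ∈ affineComponent ε H P γ := by
  rw [affineComponent, if_pos hγ]
  exact ⟨x, hx, hy.symm⟩

omit [FiniteDimensional ℂ 𝔤] [LieAlgebra.IsSimple ℂ 𝔤] in
theorem exists_of_mem_affineComponent {γ : Dual ℂ H × ℤ} {y : P}
    (hy : y ∈ affineComponent ε H P γ) :
    ∃ x ∈ rootSpace H γ.1, (y : 𝔞) = ε γ.2 x := by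
  rw [affineComponent] at hy
  split_ifs at hy with h
  · obtain ⟨x, hx, hxy⟩ := hy
    exact ⟨x, hx, hxy.symm⟩
  · refine ⟨0, zero_mem _, ?_⟩
    rw [(Submodule.mem_bot ℂ).1 hy]
    simp

omit [FiniteDimensional ℂ 𝔤] [LieAlgebra.IsSimple ℂ 𝔤] in
theorem affineComponent_of_neg {γ : Dual ℂ H × ℤ} (hγ : γ.2 < 0) :
    affineComponent ε H P γ = ⊥ := by
  rw [affineComponent, if_neg hγ.not_ge]

omit [FiniteDimensional ℂ 𝔤] [LieAlgebra.IsSimple ℂ 𝔤] in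
include hε in
theorem lie_mem_affineComponent {γ₁ γ₂ : Dual ℂ H × ℤ} {x y : P}
    (hx : x ∈ affineComponent ε H P γ₁) (hy : y ∈ affineComponent ε H P γ₂) :
    ⁅x, y⁆ ∈ affineComponent ε H P (γ₁ + γ₂) := by
  rcases lt_or_ge γ₁.2 0 with h₁ | h₁
  · rw [affineComponent_of_neg h₁, Submodule.mem_bot] at hx
    rw [hx, zero_lie]
    exact zero_mem _
  rcases lt_or_ge γ₂.2 0 with h₂ | h₂
  · rw [affineComponent_of_neg h₂, Submodule.mem_bot] at hy
    rw [hy, lie_zero]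
    exact zero_mem _
  obtain ⟨x', hx', hxx⟩ := exists_of_mem_affineComponent hx
  obtain ⟨y', hy', hyy⟩ := exists_of_mem_affineComponent hy
  have hlie : ⁅x', y'⁆ ∈ rootSpace H (γ₁ + γ₂).1 := by
    rw [Prod.fst_add]
    exact lie_mem_rootSpace_add hx' hy'
  have hxy : ((⁅x, y⁆ : P) : 𝔞) = ε (γ₁ + γ₂).2 ⁅x', y'⁆ := by
    rw [LieSubalgebra.coe_bracket, hxx, hyy, hε.lie_apply _ _ x' y' h₁ h₂, Prod.snd_add]
  exact mem_affineComponent (add_nonneg h₁ h₂) hlie hxy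

omit [FiniteDimensional ℂ 𝔤] [LieAlgebra.IsSimple ℂ 𝔤] in
include hε in
-- The coefficient of `t^γ.2` kills components with another power of `t` and sends the remaining
-- ones into other root spaces, reducing to independence of root spaces in `𝔤`.
theorem iSupIndep_affineComponent : iSupIndep (affineComponent ε H P) := by
  intro γ
  rw [Submodule.disjoint_def]
  intro x hx hx'
  obtain ⟨y, hy, hxy⟩ := exists_of_mem_affineComponent hx
  let φ : P →ₗ[ℂ] 𝔤 :=
    coeff γ.2 ∘ₗ P.toSubmodule.subtype
  have hφ : ∀ z, φ z = coeff γ.2 z := fun _ => rfl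
  have hind : iSupIndep fun β : Dual ℂ H => (rootSpace H β : Submodule ℂ 𝔤) :=
    (LieSubmodule.iSupIndep_toSubmodule.2 (iSupIndep_genWeightSpace ℂ H 𝔤)).comp
      (f := fun β : Dual ℂ H => (β : H → ℂ)) DFunLike.coe_injective
  have hle : (⨆ (γ') (_ : γ' ≠ γ), affineComponent ε H P γ') ≤
      (⨆ (β) (_ : β ≠ γ.1), (rootSpace H β : Submodule ℂ 𝔤)).comap φ := by
    refine iSup₂_le fun γ' hne z hz => ?_
    obtain ⟨w, hw, hzw⟩ := exists_of_mem_affineComponent hz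
    rw [Submodule.mem_comap, hφ, hzw, hε.coeff_apply]
    split_ifs with h
    · exact Submodule.mem_iSup_of_mem γ'.1
        (Submodule.mem_iSup_of_mem (fun h1 => hne (Prod.ext h1 h)) hw)
    · exact zero_mem _
  have h1 : φ x = y := by rw [hφ, hxy, hε.coeff_apply, if_pos rfl]
  have h2 := hle hx'
  rw [Submodule.mem_comap, h1] at h2
  have h3 := Submodule.disjoint_def.1 (hind γ.1) y hy h2
  apply Subtype.ext
  rw [hxy, h3, map_zero]
  rfl

omit [FiniteDimensional ℂ 𝔤] [LieAlgebra.IsSimple ℂ 𝔤] in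
include hε in
theorem finrank_affineComponent {γ : Dual ℂ H × ℤ} (h0 : 0 ≤ γ.2)
    (h : ∀ x ∈ rootSpace H γ.1, ε γ.2 x ∈ P) :
    finrank ℂ (affineComponent ε H P γ) = finrank ℂ (rootSpace H γ.1) := by
  rw [affineComponent, if_pos h0]
  have hle : (rootSpace H γ.1 : Submodule ℂ 𝔤).map (ε γ.2) ≤
      P.toSubmodule := by
    rintro _ ⟨x, hx, rfl⟩
    exact h x hx
  exact (Submodule.comapSubtypeEquivOfLe hle).finrank_eq.trans
    (Submodule.equivMapOfInjective _ (hε.injective γ.2) _).finrank_eq.symm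

end Component

variable (hε : IsLoopEmbedding ε coeff) {P : LieSubalgebra ℂ 𝔞}
    (b : (rootSystem H).Base) {θ : H.root}
    (hθ : ∀ β : H.root, b.height β ≤ b.height θ)
    {e : b.support → 𝔤}
    (he : ∀ i : b.support, e i ∈ rootSpace H ((rootSystem H).root i) ∧ e i ≠ 0)
    {f : 𝔤} (hf : f ∈ rootSpace H (-(rootSystem H).root θ) ∧ f ≠ 0)
    {g : AffineNode b.support → P} (hg0 : (g .zero : 𝔞) = ε 1 f)
    (hg : ∀ i, (g (.node i) : 𝔞) = ε 0 (e i))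

include hε he hg in
theorem IsLoopEmbedding.zero_mem {β : H.root} (hβ : b.IsPos β) {x : 𝔤}
    (hx : x ∈ rootSpace H ((rootSystem H).root β)) :
    ε 0 x ∈ P := by
  let K : LieSubalgebra ℂ 𝔤 :=
    { P.toSubmodule.comap (ε 0) with
      lie_mem' := fun {y z} hy hz => by
        have := P.lie_mem hy hz
        rwa [hε.lie_apply _ _ _ _ le_rfl le_rfl, add_zero] at this }
  refine rootSpace_le_of_isPos b (K := K) (fun i hi y hy => ?_) hβ hx
  obtain ⟨c, rfl⟩ := exists_smul_eq_of_mem_rootSpace i (he ⟨i, hi⟩).1 (he ⟨i, hi⟩).2 hy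
  exact K.smul_mem c (show ε 0 (e ⟨i, hi⟩) ∈ P from hg _ ▸ (g _).2)

include hε hθ he hf hg0 hg in
-- In degree one, the `x` with `x t ∈ P` form a subspace containing `f` and stable under the `e_i`,
-- hence all of `𝔤`. Higher powers follow from `[𝔤 tⁿ, 𝔤 t] = 𝔤 tⁿ⁺¹`.
theorem IsLoopEmbedding.succ_mem (n : ℕ) (x : 𝔤) :
    ε (n + 1) x ∈ P := by
  have h1 : ∀ x, ε 1 x ∈ P := by
    have htop := eq_top_of_lowest_mem b hθ he hf
      (W := P.toSubmodule.comap (ε 1))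
      (show ε 1 f ∈ P from hg0 ▸ (g _).2) (fun i y hy => ?_)
    · intro y
      have hy : y ∈ (⊤ : Submodule ℂ 𝔤) := Submodule.mem_top
      rwa [← htop] at hy
    · have := P.lie_mem (show ε 0 (e i) ∈ P from hg _ ▸ (g _).2) hy
      have h2 := hε.lie_apply _ _ (e i) y le_rfl zero_le_one
      rw [zero_add] at h2
      rw [Submodule.mem_comap, ← h2]
      exact this
  induction n generalizing x with
  | zero => simpa using h1 x
  | succ n ih =>
    have hle : (⊤ : Submodule ℂ 𝔤) ≤ P.toSubmodule.comap
        (ε ((n + 1 : ℕ) + 1)) := by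
      rw [← span_lie_eq_top, Submodule.span_le]
      rintro _ ⟨y, z, rfl⟩
      have := P.lie_mem (ih y) (h1 z)
      rw [hε.lie_apply _ _ _ _ (by omega) zero_le_one] at this
      simpa using this
    exact hle Submodule.mem_top

include hε hθ he hf hg0 hg in
theorem finrank_affineComponent_of_isPosAffineRoot {γ : Dual ℂ H × ℤ}
    (hγ : IsPosAffineRoot b γ) :
    finrank ℂ (affineComponent ε H P γ) = finrank ℂ (rootSpace H γ.1) := by
  have hpos : 0 < γ.2 → finrank ℂ (affineComponent ε H P γ) =
      finrank ℂ (rootSpace H γ.1) := fun h => by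
    refine finrank_affineComponent hε h.le fun x _ => ?_
    obtain ⟨n, hn⟩ : ∃ n : ℕ, γ.2 = n + 1 := ⟨(γ.2 - 1).toNat, by omega⟩
    rw [hn]
    exact hε.succ_mem b hθ he hf hg0 hg n x
  obtain ⟨γ₁, n⟩ := γ
  rcases hγ with ⟨β, hβ, ⟨h1, h2⟩ | ⟨-, h2⟩⟩ | ⟨-, h2⟩
  · rcases h2.eq_or_lt with h0 | h0
    · refine finrank_affineComponent hε h2 fun x hx => ?_
      dsimp only at h0 h1 hx
      subst h0 h1
      exact hε.zero_mem b he hg hβ hx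
    · exact hpos h0
  · exact hpos h2
  · exact hpos h2

include hε hθ he hf hg0 hg in
theorem finrank_affineComponent_of_isPosReal {γ : Dual ℂ H × ℤ} (hγ : IsPosReal b γ) :
    finrank ℂ (affineComponent ε H P γ) = 1 := by
  let := (rootSystem H).indexNeg
  rw [finrank_affineComponent_of_isPosAffineRoot hε b hθ he hf hg0 hg (Or.inl hγ)]
  obtain ⟨β, -, ⟨h, -⟩ | ⟨h, -⟩⟩ := hγ
  · rw [h, finrank_rootSpace_root]
  · rw [h, ← root_indexNeg, finrank_rootSpace_root]

include hε hθ he hf hg0 hg in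
theorem finrank_affineComponent_of_isPosImag {γ : Dual ℂ H × ℤ} (hγ : IsPosImag γ) :
    finrank ℂ (affineComponent ε H P γ) = b.support.card := by
  rw [finrank_affineComponent_of_isPosAffineRoot hε b hθ he hf hg0 hg (Or.inr hγ), hγ.1]
  have h0 : ((0 : Dual ℂ H) : H → ℂ) = 0 := rfl
  rw [h0, rootSpace_zero_eq]
  -- The simple roots form a basis of the dual of the Cartan subalgebra.
  have h1 : finrank ℂ H = finrank ℂ (Dual ℂ H) := Subspace.dual_finrank_eq.symm
  have h2 := finrank_eq_card_basis b.toWeightBasis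
  rw [Fintype.card_coe] at h2
  exact h1.trans h2

/-- The height function on `Q × ℤ` that takes the value one on all affine simple roots. -/
def affineHeight (θ : H.root) : Dual ℂ H × ℤ →+ ℂ where
  -- The weight `ht θ + 1` of `δ` is what gives `α₀ = (-θ, 1)` height one. Values are complex since
  -- the first coordinate ranges over the whole dual of `H`.
  toFun γ := b.toWeightBasis.constr ℂ (fun _ => (1 : ℂ)) γ.1 + γ.2 * (b.height θ + 1)
  map_zero' := by simp
  map_add' γ γ' := by
    simp only [Prod.fst_add, Prod.snd_add, map_add, Int.cast_add]
    ring

theorem affineHeight_apply_root (β : H.root) (n : ℤ) :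
    affineHeight b θ ((rootSystem H).root β, n) =
      ((b.height β + n * (b.height θ + 1) : ℤ) : ℂ) := by
  obtain ⟨g, -, -, hg⟩ := b.exists_root_eq_sum_int β
  have h1 : ∀ i ∈ b.support,
      b.toWeightBasis.constr ℂ (fun _ => (1 : ℂ)) ((rootSystem H).root i) = 1 := by
    intro i hi
    have := b.toWeightBasis.constr_basis ℂ (fun _ => (1 : ℂ)) ⟨i, hi⟩
    rwa [RootPairing.Base.toWeightBasis_apply] at this
  have h2 : b.toWeightBasis.constr ℂ (fun _ => (1 : ℂ)) ((rootSystem H).root β) = b.height β := by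
    rw [RootPairing.Base.height_eq_sum hg, hg, map_sum, Int.cast_sum]
    refine Finset.sum_congr rfl fun i hi => ?_
    rw [map_zsmul, h1 i hi]
    simp
  change b.toWeightBasis.constr ℂ (fun _ => (1 : ℂ)) ((rootSystem H).root β) +
    (n : ℂ) * (b.height θ + 1) = _
  rw [h2]
  push_cast
  ring

theorem affineHeight_apply_neg_root (β : H.root) (n : ℤ) :
    affineHeight b θ (-(rootSystem H).root β, n) =
      ((-b.height β + n * (b.height θ + 1) : ℤ) : ℂ) := by
  let := (rootSystem H).indexNeg
  rw [← root_indexNeg, affineHeight_apply_root, RootPairing.Base.height_reflectionPerm_self]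

theorem affineHeight_affineSimpleRoot (i : AffineNode b.support) :
    affineHeight b θ (affineSimpleRoot b θ i) = 1 := by
  cases i with
  | zero => rw [affineSimpleRoot, affineHeight_apply_neg_root]; simp
  | node i =>
    rw [affineSimpleRoot, affineHeight_apply_root, b.height_one_of_mem_support i.2]
    simp

theorem affineHeight_wordDegree (w : List (AffineNode b.support)) :
    affineHeight b θ (wordDegree b θ w) = w.length := by
  induction w with
  | nil => simp [wordDegree]
  | cons i w ih =>
    rw [wordDegree] at ih ⊢
    rw [List.map_cons, List.sum_cons, map_add, ih, affineHeight_affineSimpleRoot]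
    push_cast [List.length_cons]
    ring

include hθ in
-- For `-β + nδ` with `n ≥ 1` positivity holds because `ht β ≤ ht θ < ht θ + 1`.
theorem exists_affineHeight_eq {γ : Dual ℂ H × ℤ} (hγ : IsPosAffineRoot b γ) :
    ∃ k : ℕ, 0 < k ∧ affineHeight b θ γ = k := by
  suffices ∃ k : ℤ, 0 < k ∧ affineHeight b θ γ = k by
    obtain ⟨k, hk, h⟩ := this
    exact ⟨k.toNat, by omega, by rw [h, ← Int.cast_natCast, Int.toNat_of_nonneg hk.le]⟩
  have hpos := isPos_highestRoot b hθ
  rw [RootPairing.Base.isPos_iff] at hpos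
  obtain ⟨γ₁, n⟩ := γ
  rcases hγ with ⟨β, hβ, ⟨h1, h2⟩ | ⟨h1, h2⟩⟩ | ⟨h1, h2⟩
  · dsimp only at h1 h2
    rw [RootPairing.Base.isPos_iff] at hβ
    subst h1
    exact ⟨_, by positivity, affineHeight_apply_root b β n⟩
  · dsimp only at h1 h2
    subst h1
    refine ⟨_, ?_, affineHeight_apply_neg_root b β n⟩
    have := hθ β
    nlinarith
  · dsimp only at h1 h2
    subst h1
    refine ⟨n * (b.height θ + 1), by positivity, ?_⟩
    simp [affineHeight]

theorem wordDegree_append (u v : List (AffineNode b.support)) :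
    wordDegree b θ (u ++ v) = wordDegree b θ u + wordDegree b θ v := by
  simp [wordDegree]

theorem wordDegree_singleton (i : AffineNode b.support) :
    wordDegree b θ [i] = affineSimpleRoot b θ i := by
  simp [wordDegree]

include he hf hg0 hg in
theorem affinePosGen_mem_affineComponent (i : AffineNode b.support) :
    g i ∈ affineComponent ε H P (affineSimpleRoot b θ i) := by
  rcases i with _ | i
  · exact mem_affineComponent (γ := (-(rootSystem H).root θ, 1)) zero_le_one hf.1 hg0
  · exact mem_affineComponent (γ := ((rootSystem H).root i, 0)) le_rfl (he i).1 (hg i)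

variable [LinearOrder (AffineNode b.support)]

include hε he hf hg0 hg in
theorem isWordGrading_affinePos (hP : LieSubalgebra.lieSpan ℂ P (Set.range g) = ⊤) :
    IsWordGrading g (wordDegree b θ)
      (affineComponent ε H P) := by
  have hmem : ∀ n, ∀ w : List (AffineNode b.support), w.length = n →
      stdBracketing g w ∈
        affineComponent ε H P (wordDegree b θ w) := by
    intro n
    induction n using Nat.strong_induction_on with
    | _ n ih =>
    rintro w rfl
    rcases lt_or_ge w.length 2 with h | h
    · match w, h with
      | [], _ =>
        rw [stdBracketing]
        exact zero_mem _
      | [i], _ =>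
        rw [stdBracketing_singleton, wordDegree_singleton]
        exact affinePosGen_mem_affineComponent b he hf hg0 hg i
    · have hspec := costandardIndex_spec h
      rw [stdBracketing_of_two_le _ h]
      have hd : wordDegree b θ w = wordDegree b θ (w.take (costandardIndex w)) +
          wordDegree b θ (w.drop (costandardIndex w)) := by
        rw [← wordDegree_append, List.take_append_drop]
      rw [hd]
      refine lie_mem_affineComponent hε (ih _ ?_ _ rfl) (ih _ ?_ _ rfl)
      · rw [List.length_take]; omega
      · rw [List.length_drop]; omega
  refine ⟨iSupIndep_affineComponent hε, fun w => hmem _ w rfl, fun u v => ?_,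
    fun u v h => ?_, hP⟩
  · rw [wordDegree_append]
    exact lie_mem_affineComponent hε (hmem _ u rfl) (hmem _ v rfl)
  · have := congrArg (affineHeight b θ) h
    rw [affineHeight_wordDegree, affineHeight_wordDegree] at this
    exact_mod_cast this

end AffineGrading

/-! ### The Leclerc rules: validity and uniqueness -/

section Leclerc

open LieAlgebra LieAlgebra.IsKilling LieModule Module

variable {𝔤 : Type*} [LieRing 𝔤] [LieAlgebra ℂ 𝔤] [FiniteDimensional ℂ 𝔤]
  [LieAlgebra.IsSimple ℂ 𝔤] {H : LieSubalgebra ℂ 𝔤} [H.IsCartanSubalgebra]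
  {b : (rootSystem H).Base} {θ : H.root}

instance finite_affineNode {I : Type*} [Finite I] : Finite (AffineNode I) :=
  Finite.of_surjective (fun i : Option I => i.elim AffineNode.zero AffineNode.node) fun i => by
    cases i with
    | zero => exact ⟨none, rfl⟩
    | node i => exact ⟨some i, rfl⟩

theorem affineSimpleRoot_injective : Function.Injective (affineSimpleRoot b θ) := by
  intro i j h
  rcases i with _ | i <;> rcases j with _ | j
  · rfl
  · exact absurd (congrArg Prod.snd h) (by simp [affineSimpleRoot])
  · exact absurd (congrArg Prod.snd h) (by simp [affineSimpleRoot])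
  · rw [Subtype.ext ((rootSystem H).root.injective (congrArg Prod.fst h))]

theorem affineSimpleRoot_fst_ne_zero (i : AffineNode b.support) :
    (affineSimpleRoot b θ i).1 ≠ 0 := by
  rcases i with _ | i
  · exact neg_ne_zero.2 ((rootSystem H).ne_zero θ)
  · exact (rootSystem H).ne_zero i

theorem isPosReal_affineSimpleRoot (hθ : ∀ β : H.root, b.height β ≤ b.height θ)
    (i : AffineNode b.support) : IsPosReal b (affineSimpleRoot b θ i) := by
  rcases i with _ | i
  · exact ⟨θ, isPos_highestRoot b hθ, Or.inr ⟨rfl, zero_lt_one⟩⟩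
  · exact ⟨i, b.isPos_of_mem_support i.2, Or.inl ⟨rfl, le_rfl⟩⟩

variable [LinearOrder (AffineNode b.support)] {L : Type*} [LieRing L] [LieAlgebra ℂ L]
  {e : AffineNode b.support → L} {V : Dual ℂ H × ℤ → Submodule ℂ L}

/-- A standard Lyndon word whose degree is not an affine simple root is a Leclerc concatenation. -/
theorem mem_leclercConcatenations (hV : IsWordGrading e (wordDegree b θ) V)
    (hpos : ∀ w, IsStdLyndon e w → IsPosAffineRoot b (wordDegree b θ w))
    {w : List (AffineNode b.support)} (hw : IsStdLyndon e w)
    (hns : ∀ i, wordDegree b θ w ≠ affineSimpleRoot b θ i) :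
    w ∈ leclercConcatenations b e (stdLyndonOfDegree b θ e) (wordDegree b θ w) := by
  have hl : 2 ≤ w.length := by
    match w, hw, hns with
    | [], hw, _ => exact absurd rfl hw.1.ne_nil
    | [i], _, hns => exact absurd (wordDegree_singleton b i) (hns i)
    | _ :: _ :: _, _, _ => simp
  have hne : stdBracketing e w ≠ 0 := fun h => hw.2 (h ▸ zero_mem _)
  obtain ⟨u, v, rfl, hu, hv, huv, hbr⟩ := hV.exists_factorization hw hl
  exact ⟨_, _, hpos u hu, hpos v hv, (wordDegree_append b u v).symm, u, ⟨hu, rfl⟩, v, ⟨hv, rfl⟩,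
    huv, hbr ▸ hne, rfl⟩

theorem exists_of_mem_leclercConcatenations {α : Dual ℂ H × ℤ} {w : List (AffineNode b.support)}
    (hw : w ∈ leclercConcatenations b e (stdLyndonOfDegree b θ e) α) :
    ∃ u v, w = u ++ v ∧ IsLyndon u ∧ IsLyndon v ∧ u < v ∧ wordDegree b θ w = α ∧
      ⁅stdBracketing e u, stdBracketing e v⁆ ≠ 0 := by
  obtain ⟨γ₁, γ₂, -, -, hα, u, ⟨hu, hu'⟩, v, ⟨hv, hv'⟩, huv, h0, rfl⟩ := hw
  exact ⟨u, v, rfl, hu.1, hv.1, huv, by rw [wordDegree_append, hu', hv', hα], h0⟩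

/-- The standard Lyndon words satisfy the rules of the generalized Leclerc algorithm. -/
theorem leclercRules_stdLyndonOfDegree (hθ : ∀ β : H.root, b.height β ≤ b.height θ)
    (hV : IsWordGrading e (wordDegree b θ) V)
    (hpos : ∀ w, IsStdLyndon e w → IsPosAffineRoot b (wordDegree b θ w))
    (hreal : ∀ α, IsPosReal b α → finrank ℂ (V α) = 1)
    (himag : ∀ α, IsPosImag α → finrank ℂ (V α) = b.support.card) :
    LeclercRules b θ e (stdLyndonOfDegree b θ e) where
  simple i := by
    have hcard : (stdLyndonOfDegree b θ e (affineSimpleRoot b θ i)).ncard = 1 :=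
      (hV.ncard_isStdLyndon _).trans (hreal _ (isPosReal_affineSimpleRoot hθ i))
    obtain ⟨w, hw⟩ := Set.ncard_eq_one.1 hcard
    have hmem : w ∈ stdLyndonOfDegree b θ e (affineSimpleRoot b θ i) := hw ▸ rfl
    -- The degree determines the length, so the unique word of degree `α_i` is a single letter.
    have hl : w.length = [i].length :=
      hV.length_eq _ _ (hmem.2.trans (wordDegree_singleton b i).symm)
    obtain ⟨j, rfl⟩ := List.length_eq_one_iff.1 hl
    rw [hw, affineSimpleRoot_injective ((wordDegree_singleton b j).symm.trans hmem.2)]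
  real α hα hns := by
    have hcard : (stdLyndonOfDegree b θ e α).ncard = 1 :=
      (hV.ncard_isStdLyndon _).trans (hreal α hα)
    obtain ⟨w, hw⟩ := Set.ncard_eq_one.1 hcard
    have hmem : w ∈ stdLyndonOfDegree b θ e α := hw ▸ rfl
    refine ⟨w, hw, ?_, fun x hx => ?_⟩
    · have := mem_leclercConcatenations hV hpos hmem.1 (by rwa [hmem.2])
      rwa [hmem.2] at this
    · obtain ⟨u, v, rfl, hu, hv, huv, hd, h0⟩ := exists_of_mem_leclercConcatenations hx
      obtain ⟨m, hm, hmd, hle⟩ := hV.exists_isStdLyndon_ge hu hv huv h0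
      have hm' : m ∈ stdLyndonOfDegree b θ e α := ⟨hm, hmd.trans hd⟩
      rw [hw, Set.mem_singleton_iff] at hm'
      exact hm' ▸ hle
  imag α hα := by
    have hfin : (stdLyndonOfDegree b θ e α).Finite := hV.finite_isStdLyndon α
    have hcard : hfin.toFinset.card = b.support.card := by
      rw [← Set.ncard_eq_toFinset_card _ hfin]
      exact (hV.ncard_isStdLyndon α).trans (himag α hα)
    have hmem : ∀ j, hfin.toFinset.orderEmbOfFin hcard j ∈ stdLyndonOfDegree b θ e α :=
      fun j => hfin.mem_toFinset.1 (Finset.orderEmbOfFin_mem _ hcard j)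
    -- `orderEmbOfFin` enumerates increasingly; reversing the index lists the words from the largest
    -- down.
    have hanti : StrictAnti fun j : Fin b.support.card =>
        hfin.toFinset.orderEmbOfFin hcard j.rev :=
      fun i j hij => (hfin.toFinset.orderEmbOfFin hcard).strictMono (Fin.rev_lt_rev.2 hij)
    have hrange : stdLyndonOfDegree b θ e α =
        Set.range fun j : Fin b.support.card => hfin.toFinset.orderEmbOfFin hcard j.rev := by
      have h1 := Fin.rev_surjective.range_comp (hfin.toFinset.orderEmbOfFin hcard)
      rw [Finset.range_orderEmbOfFin, hfin.coe_toFinset] at h1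
      exact h1.symm
    refine ⟨fun j => hfin.toFinset.orderEmbOfFin hcard j.rev, hanti, hrange, ?_, fun j => ⟨⟨?_, ?_⟩,
      fun x hx => ?_⟩⟩
    · exact (IsWordGrading.linearIndependent_isStdLyndon (e := e)
        (T := stdLyndonOfDegree b θ e α) fun m hm => hm.1).comp (fun j => ⟨_, hmem (Fin.rev j)⟩)
        fun i j hij => hanti.injective (Subtype.mk_eq_mk.1 hij)
    · have h := hmem j.rev
      have := mem_leclercConcatenations hV hpos h.1 fun i hi =>
        affineSimpleRoot_fst_ne_zero (b := b) (θ := θ) i (by rw [← hi, h.2]; exact hα.1)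
      rwa [h.2] at this
    · refine fun h => (hmem j.rev).1.2 (Submodule.span_mono ?_ h)
      rintro _ ⟨i, hi, rfl⟩
      exact ⟨_, ⟨(hmem i.rev).1.1, hanti hi⟩, rfl⟩
    -- If `x` exceeded the `j`-th word, `b[x]` would be a combination of standard words `≥ x`, all
    -- of them among the earlier choices.
    · by_contra! hlt
      obtain ⟨u, v, hx', hu, hv, huv, hd, -⟩ := exists_of_mem_leclercConcatenations hx.1
      have hL : IsLyndon x := hx' ▸ hu.append hv huv
      refine hx.2 (Submodule.span_mono ?_ (hV.mem_span_isStdLyndon hL))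
      rintro _ ⟨m, ⟨hm, hle, hmd⟩, rfl⟩
      have hm' : m ∈ stdLyndonOfDegree b θ e α := ⟨hm, hmd.trans hd⟩
      rw [hrange] at hm'
      obtain ⟨i, rfl⟩ := hm'
      exact ⟨i, hanti.lt_iff_gt.1 (hlt.trans_le hle), rfl⟩

/-- The rules of the generalized Leclerc algorithm have at most one solution. -/
theorem LeclercRules.unique (hθ : ∀ β : H.root, b.height β ≤ b.height θ)
    {S S' : Dual ℂ H × ℤ → Set (List (AffineNode b.support))} (hS : LeclercRules b θ e S)
    (hS' : LeclercRules b θ e S') {α : Dual ℂ H × ℤ} (hα : IsPosAffineRoot b α) :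
    S α = S' α := by
  obtain ⟨k, -, hk⟩ := exists_affineHeight_eq b hθ hα
  induction k using Nat.strong_induction_on generalizing α with
  | _ k ih =>
  have hIH : ∀ γ γ', IsPosAffineRoot b γ → IsPosAffineRoot b γ' → γ + γ' = α → S γ = S' γ := by
    intro γ γ' hγ hγ' hsum
    obtain ⟨m, hm0, hm⟩ := exists_affineHeight_eq b hθ hγ
    obtain ⟨m', hm0', hm'⟩ := exists_affineHeight_eq b hθ hγ'
    have h : m + m' = k := by
      rw [← hsum, map_add, hm, hm'] at hk
      exact_mod_cast hk
    exact ih m (by omega) hγ hm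
  -- Both summands of `α` have smaller height, so `S` and `S'` agree on them by induction.
  have hC : leclercConcatenations b e S α = leclercConcatenations b e S' α := by
    ext w
    refine exists_congr fun γ₁ => exists_congr fun γ₂ => and_congr_right fun h₁ =>
      and_congr_right fun h₂ => and_congr_right fun hsum => ?_
    rw [hIH γ₁ γ₂ h₁ h₂ hsum, hIH γ₂ γ₁ h₂ h₁ (by rw [add_comm, hsum])]
  by_cases hsimple : ∃ i, α = affineSimpleRoot b θ i
  · obtain ⟨i, rfl⟩ := hsimple
    rw [hS.simple, hS'.simple]
  push Not at hsimple
  rcases hα with hα | hα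
  · obtain ⟨w, hw, hmax⟩ := hS.real α hα hsimple
    obtain ⟨w', hw', hmax'⟩ := hS'.real α hα hsimple
    rw [hw, hw', hmax.unique (hC ▸ hmax')]
  · obtain ⟨s, -, hs, -, hmax⟩ := hS.imag α hα
    obtain ⟨s', -, hs', -, hmax'⟩ := hS'.imag α hα
    suffices s = s' by rw [hs, hs', this]
    funext j
    induction j using WellFoundedLT.induction with
    | _ j ihj =>
    have himg : (fun i => stdBracketing e (s i)) '' Set.Iio j =
        (fun i => stdBracketing e (s' i)) '' Set.Iio j :=
      Set.image_congr fun i hi => by rw [ihj i hi]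
    have h := hmax j
    rw [himg, hC] at h
    exact h.unique (hmax' j)

end Leclerc

/-! ### The affine Lie algebra as a loop embedding, and the conclusion -/

section Affine

open LieAlgebra LieAlgebra.IsKilling LieModule Module

variable {𝔤 : Type*} [LieRing 𝔤] [LieAlgebra ℂ 𝔤] (κ : LinearMap.BilinForm ℂ 𝔤)
  (hκ : κ.lieInvariant 𝔤) (hs : κ.IsSymm)

/-- The embedding `x ↦ x tⁿ` of `𝔤` in the affine Lie algebra. -/
def affineMonomial (n : ℤ) : 𝔤 →ₗ[ℂ] AffineLieAlgebra κ hκ hs where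
  toFun x := affineElt κ hκ hs x n 0
  map_add' x y := by
    simp only [affineElt, TensorProduct.tmul_add, map_zero, ← LieAlgebra.of_add, Prod.mk_add_mk,
      add_zero]
  map_smul' c x := by
    simp only [affineElt, TensorProduct.tmul_smul, map_zero, RingHom.id_apply, ← LieAlgebra.of_smul,
      Prod.smul_mk, smul_zero]

/-- The coefficient of `tⁿ` of an element of the affine Lie algebra. -/
def affineCoeff (n : ℤ) : AffineLieAlgebra κ hκ hs →ₗ[ℂ] 𝔤 where
  toFun x := LoopAlgebra.toFinsupp ℂ ℤ 𝔤 ((LieAlgebra.ofProd _).symm x).1 n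
  map_add' x y := by simp
  map_smul' c x := by simp

theorem affineMonomial_apply (n : ℤ) (x : 𝔤) :
    affineMonomial κ hκ hs n x = affineElt κ hκ hs x n 0 := rfl

theorem isLoopEmbedding_affineMonomial :
    IsLoopEmbedding (affineMonomial κ hκ hs) (affineCoeff κ hκ hs) where
  coeff_apply n m x := by
    change LoopAlgebra.toFinsupp ℂ ℤ 𝔤 (AddMonoidAlgebra.single m 1 ⊗ₜ[ℂ] x) n = _
    rw [LoopAlgebra.toFinsupp_single_tmul, Finsupp.single_apply]
  lie_apply n m x y hn hm := by
    rw [affineMonomial_apply, affineMonomial_apply, affineLieAlgebra_bracket, affineMonomial_apply]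
    congr 1
    -- For nonnegative exponents `n = -m` forces `n = 0`, and the factor `n` kills the central term.
    split_ifs with h
    · obtain rfl : n = 0 := by omega
      simp
    · rfl

end Affine

/-- The degree of a nonzero component of the positive subalgebra that has positive height is a
positive affine root. -/
theorem isPosAffineRoot_of_rootSpace_ne_bot {𝔤 : Type*} [LieRing 𝔤] [LieAlgebra ℂ 𝔤]
    [FiniteDimensional ℂ 𝔤] [LieAlgebra.IsSimple ℂ 𝔤] {H : LieSubalgebra ℂ 𝔤}
    [H.IsCartanSubalgebra] (b : (LieAlgebra.IsKilling.rootSystem H).Base) {θ : H.root}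
    {γ : Module.Dual ℂ H × ℤ} (h0 : 0 ≤ γ.2)
    (hγ : LieAlgebra.rootSpace H γ.1 ≠ ⊥) {k : ℕ} (hk : 0 < k)
    (hh : affineHeight b θ γ = k) : IsPosAffineRoot b γ := by
  let := (LieAlgebra.IsKilling.rootSystem H).indexNeg
  obtain ⟨γ₁, n⟩ := γ
  dsimp only at h0 hγ
  by_cases hz : γ₁ = 0
  · refine Or.inr ⟨hz, lt_of_le_of_ne h0 ?_⟩
    rintro rfl
    subst hz
    have : affineHeight b θ (0, 0) = 0 := map_zero _
    rw [this] at hh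
    exact hk.ne (by exact_mod_cast hh)
  obtain ⟨β, rfl⟩ := exists_root_of_rootSpace_ne_bot hγ hz
  rcases RootPairing.Base.IsPos.or_neg b β with hβ | hβ
  · exact Or.inl ⟨β, hβ, Or.inl ⟨rfl, h0⟩⟩
  · refine Or.inl ⟨-β, hβ, Or.inr ⟨by rw [root_indexNeg, neg_neg], lt_of_le_of_ne h0 ?_⟩⟩
    -- A negative root with `n = 0` would have negative height.
    rintro rfl
    rw [affineHeight_apply_root] at hh
    rw [RootPairing.Base.isPos_iff, RootPairing.Base.height_reflectionPerm_self] at hβ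
    have h1 : b.height β + 0 * (b.height θ + 1) = k := by exact_mod_cast hh
    omega

end

theorem mainTheorem1 {𝔤 : Type*} [LieRing 𝔤] [LieAlgebra ℂ 𝔤] [FiniteDimensional ℂ 𝔤]
    [LieAlgebra.IsSimple ℂ 𝔤] (H : LieSubalgebra ℂ 𝔤) [H.IsCartanSubalgebra]
    (b : (LieAlgebra.IsKilling.rootSystem H).Base)
    (θ : H.root) (hθ : ∀ β : H.root, b.height β ≤ b.height θ)
    (e : b.support → 𝔤)
    (he : ∀ i : b.support,
      e i ∈ LieAlgebra.rootSpace H ((LieAlgebra.IsKilling.rootSystem H).root i) ∧ e i ≠ 0)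
    (f : 𝔤)
    (hf : f ∈ LieAlgebra.rootSpace H (-(LieAlgebra.IsKilling.rootSystem H).root θ) ∧ f ≠ 0)
    (κ : LinearMap.BilinForm ℂ 𝔤) (hκ : κ.lieInvariant 𝔤) (hs : κ.IsSymm) (hn : κ.Nondegenerate)
    [LinearOrder (AffineNode b.support)] :
    (∀ w, IsStdLyndon (affinePosGen κ hκ hs e f) w → IsPosAffineRoot b (wordDegree b θ w)) ∧
    LeclercRules b θ (affinePosGen κ hκ hs e f)
      (stdLyndonOfDegree b θ (affinePosGen κ hκ hs e f)) ∧
    (∀ S, LeclercRules b θ (affinePosGen κ hκ hs e f) S →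
      ∀ α, IsPosAffineRoot b α →
        S α = stdLyndonOfDegree b θ (affinePosGen κ hκ hs e f) α) := by
  have hε := isLoopEmbedding_affineMonomial κ hκ hs
  have hg0 : (affinePosGen κ hκ hs e f .zero : AffineLieAlgebra κ hκ hs) =
      affineMonomial κ hκ hs 1 f := rfl
  have hg : ∀ i, (affinePosGen κ hκ hs e f (.node i) : AffineLieAlgebra κ hκ hs) =
      affineMonomial κ hκ hs 0 (e i) := fun _ => rfl
  have hP : LieSubalgebra.lieSpan ℂ (affinePos κ hκ hs e f)
      (Set.range (affinePosGen κ hκ hs e f)) = ⊤ :=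
    lieSpan_range_eq_top (g := affineGen κ hκ hs e f) rfl fun _ => rfl
  have hV := isWordGrading_affinePos hε b he hf hg0 hg hP
  have hpos : ∀ w, IsStdLyndon (affinePosGen κ hκ hs e f) w →
      IsPosAffineRoot b (wordDegree b θ w) := by
    intro w hw
    -- A standard word has nonzero bracketing, so its degree is that of a nonzero component, and its
    -- height is the positive length of the word.
    have h0 : stdBracketing (affinePosGen κ hκ hs e f) w ≠ 0 := fun h => hw.2 (h ▸ zero_mem _)
    have hmem := hV.mem w
    refine isPosAffineRoot_of_rootSpace_ne_bot b (not_lt.1 fun h => h0 ?_) (fun h => h0 ?_)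
      (List.length_pos_iff.2 hw.1.ne_nil) (affineHeight_wordDegree b w)
    · rw [affineComponent_of_neg h] at hmem
      exact (Submodule.mem_bot ℂ).1 hmem
    · obtain ⟨x, hx, hxw⟩ := exists_of_mem_affineComponent hmem
      rw [h, LieSubmodule.mem_bot] at hx
      rw [hx, map_zero] at hxw
      exact Subtype.ext hxw
  have hrules := leclercRules_stdLyndonOfDegree hθ hV hpos
    (fun α hα => finrank_affineComponent_of_isPosReal hε b hθ he hf hg0 hg hα)
    (fun α hα => finrank_affineComponent_of_isPosImag hε b hθ he hf hg0 hg hα)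
  exact ⟨hpos, hrules, fun S hS α hα => hS.unique hθ hrules hα⟩
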